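/- **Setting.** Let $\mathcal U$ be a compact, second countable Hausdorff space (for example a compact $d$-dimensional manifold, with or without boundary) with a Borel probability measure $\mu$ of full support; write $\|\cdot\|$, $\langle\cdot,\cdot\rangle$ for the norm and inner product of $L^2(\mathcal U,\mu)$. Let $K$ be a continuous, symmetric, positive definite kernel on $\mathcal U$, let $\tau_1\ge\tau_2\ge\dots>0$ be the nonzero eigenvalues (with multiplicity) of the integral operator of $K$ on $L^2(\mathcal U,\mu)$, with orthonormal eigenfunctions $v_k$, and assume $\tau_k\asymp k^{-2h}$ with $h\ge 1$. The RKHS $\mathbb K$ of $K$ consists of the continuous functions $f$ in the closed linear span of the $v_k$ in $L^2(\mathcal U,\mu)$ with $\|f\|_{\mathbb K}^2=\sum_k\tau_k^{-1}\langle f,v_k\rangle^2<\infty$. Fix $L,P\ge1$ and constants $M_0,M_\varepsilon,M_\delta,\nu>0$, $\zeta$, and $0<c\le1\le C$. For every $n$ let deterministic covariates $X_i=(X_{i1},\dots,X_{iP})\in\mathbb R^P$ and integers $m_i\ge1$, $i=1,\dots,n$, be given (both may depend on $n$), such that $|X_{ip}|\le\zeta$ and, for all large $n$, the eigenvalues of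 $n^{-1}\sum_{i=1}^nX_iX_i^\top$ lie in $[\nu^{-1},\nu]$. Let $m=\big(n^{-1}\sum_{i=1}^n m_i^{-1}\big)^{-1}$ be the harmonic mean of the $m_i$, and assume that their arithmetic mean is of the same order: $n^{-1}\sum_{i=1}^nm_i\asymp m$ as $n\to\infty$. Let $\mathcal M$ be the class of all models $$Y_{ij\ell}=\sum_{p=1}^PX_{ip}\,\beta_{\ell p}(u_{ij})+\varepsilon_{i\ell}(u_{ij})+\delta_{ij\ell},\qquad 1\le i\le n,\ 1\le j\le m_i,\ 1\le\ell\le L,$$ where $\beta_{\ell p}\in\mathbb K$ with $\|\beta_{\ell p}\|_{\mathbb K}\le M_0$; the $u_{ij}$ are i.i.d. in $\mathcal U$ with a density with respect to $\mu$ taking values in $[c,C]$; the processes $(\varepsilon_{i\ell})_{\ell\le L}$ are i.i.d. across $i$, jointly measurable, with paths in $L^2(\mathcal U,\mu)$, mean zero and $\sup_{u}\operatorname{Var}\varepsilon_{i\ell}(u)\le M_\varepsilon$; the vectors $(\delta_{ij\ell})_{\ell\le L}$ are i.i.d. across $i,j$, with mean zero and $\operatorname{Var}\delta_{ij\ell}\le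 M_\delta$; and the families $(u_{ij})$, $(\varepsilon_{i\ell})$, $(\delta_{ij\ell})$ are independent of each other. **Theorem 1 (minimax lower bound).** For any estimators $\hat\beta_{\ell p}=\hat\beta^{(n)}_{\ell p}\in L^2(\mathcal U,\mu)$ that are measurable functions of the data $\{u_{ij},Y_{ij\ell}\}$ (they may depend on all the fixed quantities above), the excess risk $R_n=\sum_{p=1}^P\sum_{\ell=1}^L\|\hat\beta_{\ell p}-\beta_{\ell p}\|^2$ satisfies $$\lim_{\epsilon\downarrow0}\ \limsup_{n\to\infty}\ \inf_{M\in\mathcal M}\ P_M\Big(R_n\le\epsilon\big((nm)^{-2h/(2h+1)}+n^{-1}\big)\Big)=0 .$$ That is, no estimator attains in the worst case a rate of smaller order than $(nm)^{-2h/(2h+1)}+n^{-1}$. -/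

import Mathlib

open MeasureTheory ProbabilityTheory Filter Topology Asymptotics
open scoped ENNReal

noncomputable section

namespace FunReg

universe w

section Kernel

variable {U : Type w} [TopologicalSpace U] [CompactSpace U] [MeasurableSpace U] [BorelSpace U]

/-- `K` is a continuous, symmetric, positive definite kernel on `U`. (For an infinite index set,
`Matrix.PosSemidef` says that `K` is symmetric and `∑ x, ∑ y, a x * a y * K x y ≥ 0` for all
finitely supported real `a`.) -/
def IsKernel (K : U → U → ℝ) : Prop :=
  Continuous (fun q : U × U => K q.1 q.2) ∧ Matrix.PosSemidef (Matrix.of K)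

/-- `(τ k, v k)`, `k = 0, 1, 2, …`, is the system of eigenvalues and eigenfunctions in `L²(U, μ)`
of the kernel `K`: the `τ k` are positive and non-increasing, the `v k` are orthonormal
eigenfunctions of the integral operator of `K`, and that operator has no further nonzero
eigenvalue, i.e. it vanishes on the orthogonal complement of the `v k`. -/
structure IsEigensystem (K : U → U → ℝ) (μ : Measure U) (τ : ℕ → ℝ) (v : ℕ → Lp ℝ 2 μ) :
    Prop where
  pos : ∀ k, 0 < τ k
  antitone : Antitone τ
  orthonormal : Orthonormal ℝ v
  eigen : ∀ k, ∀ᵐ u ∂μ, ∫ s, K u s * v k s ∂μ = τ k * v k u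
  complete : ∀ f : Lp ℝ 2 μ, (∀ k, inner ℝ (v k) f = 0) → ∀ᵐ u ∂μ, ∫ s, K u s * f s ∂μ = 0

/-- The squared RKHS norm `∑ₖ ⟨f, v k⟩² / τ k` of `f ∈ L²(U, μ)`; it is `∞` if the sum diverges or
if `f` is not in the closed linear span of the eigenfunctions. -/
def rkhsNormSq {μ : Measure U} (τ : ℕ → ℝ) (v : ℕ → Lp ℝ 2 μ) (f : Lp ℝ 2 μ) : ℝ≥0∞ :=
  open Classical in
  if f ∈ (Submodule.span ℝ (Set.range v)).topologicalClosure then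
    ∑' k, ENNReal.ofReal ((inner ℝ f (v k)) ^ 2 / τ k)
  else ⊤

/-- The closed ball of radius `M₀` of the RKHS. Its elements are the continuous representatives. -/
def rkhsBall (μ : Measure U) [IsFiniteMeasure μ] (τ : ℕ → ℝ) (v : ℕ → Lp ℝ 2 μ) (M₀ : ℝ) :
    Set C(U, ℝ) :=
  {β | rkhsNormSq τ v (ContinuousMap.toLp 2 μ ℝ β) ≤ ENNReal.ofReal (M₀ ^ 2)}

end Kernel

/-- A probability model for the functional regression: the coefficient functions `β ℓ p`, the
density `ρ` of the sampling points, the law of the error process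
`(ε ℓ (u))`, given as a process on a probability space `(E, Q)`, and the law `D` on `ℝ^L` of the
measurement error `(δ ℓ)`. -/
structure Model (U : Type w) [TopologicalSpace U] (L P : ℕ) where
  β : Fin L → Fin P → C(U, ℝ)
  ρ : U → ℝ
  E : Type
  mE : MeasurableSpace E
  Q : Measure E
  ε : E → Fin L → U → ℝ
  D : Measure (Fin L → ℝ)

attribute [instance] Model.mE

namespace Model

variable {U : Type w} [TopologicalSpace U] [CompactSpace U] [MeasurableSpace U] [BorelSpace U]
  {L P : ℕ}

/-- The law of a single sampling point. -/
def pointLaw (M : Model U L P) (μ : Measure U) : Measure U :=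
  μ.withDensity fun u => ENNReal.ofReal (M.ρ u)

/-- The model satisfies the modeling assumptions, with coefficient functions in the RKHS ball of
radius `M₀`, sampling density between `c` and `C`, and error variances at most `Mε` and `Mδ`. -/
structure Admissible (M : Model U L P) (μ : Measure U) [IsFiniteMeasure μ]
    (τ : ℕ → ℝ) (v : ℕ → Lp ℝ 2 μ) (M₀ c C Mε Mδ : ℝ) : Prop where
  β_mem : ∀ ℓ p, M.β ℓ p ∈ rkhsBall μ τ v M₀
  ρ_meas : Measurable M.ρ
  ρ_bounds : ∀ᵐ u ∂μ, c ≤ M.ρ u ∧ M.ρ u ≤ C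
  ρ_prob : IsProbabilityMeasure (M.pointLaw μ)
  Q_prob : IsProbabilityMeasure M.Q
  ε_meas : ∀ ℓ, Measurable fun q : M.E × U => M.ε q.1 ℓ q.2
  ε_path : ∀ ℓ, ∀ᵐ e ∂M.Q, MemLp (M.ε e ℓ) 2 μ
  ε_sq : ∀ ℓ u, MemLp (fun e => M.ε e ℓ u) 2 M.Q
  ε_mean : ∀ ℓ u, ∫ e, M.ε e ℓ u ∂M.Q = 0
  ε_var : ∀ ℓ u, variance (fun e => M.ε e ℓ u) M.Q ≤ Mε
  D_prob : IsProbabilityMeasure M.D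
  δ_sq : ∀ ℓ, MemLp (fun d : Fin L → ℝ => d ℓ) 2 M.D
  δ_mean : ∀ ℓ, ∫ d, d ℓ ∂M.D = 0
  δ_var : ∀ ℓ, variance (fun d : Fin L → ℝ => d ℓ) M.D ≤ Mδ

/-- The observations `(u_j, Y_j)`, `j < m`, of one subject with covariate vector `x`, error process
`e`, sampling points `u` and measurement errors `d`:
`Y_{jℓ} = ∑ₚ xₚ β_{ℓp}(u_j) + ε_ℓ(u_j) + δ_{jℓ}`. -/
def observe (M : Model U L P) (x : Fin P → ℝ) {m : ℕ}
    (ω : M.E × (Fin m → U) × (Fin m → Fin L → ℝ)) : Fin m → U × (Fin L → ℝ) :=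
  fun j => (ω.2.1 j, fun ℓ => ∑ p, x p * M.β ℓ p (ω.2.1 j) + M.ε ω.1 ℓ (ω.2.1 j) + ω.2.2 j ℓ)

/-- The law of the observations of one subject: the error process, the i.i.d. sampling points
and the i.i.d. measurement errors are independent. -/
def subjectLaw (M : Model U L P) (μ : Measure U) (x : Fin P → ℝ) (m : ℕ) :
    Measure (Fin m → U × (Fin L → ℝ)) :=
  (M.Q.prod ((Measure.pi fun _ : Fin m => M.pointLaw μ).prod
    (Measure.pi fun _ : Fin m => M.D))).map (M.observe x)

/-- The law of the whole sample: the `n` subjects are independent, subject `i` has covariates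
`X i` and `m i` sampling points. -/
def sampleLaw (M : Model U L P) (μ : Measure U) {n : ℕ} (X : Fin n → Fin P → ℝ)
    (m : Fin n → ℕ) : Measure ((i : Fin n) → Fin (m i) → U × (Fin L → ℝ)) :=
  Measure.pi fun i => M.subjectLaw μ (X i) (m i)

/-- The excess risk `∑ₚ ∑_ℓ ‖b ℓ p - β ℓ p‖²` in `L²(U, μ)`. -/
def excessRisk (M : Model U L P) (μ : Measure U) [IsFiniteMeasure μ]
    (b : Fin L → Fin P → Lp ℝ 2 μ) : ℝ :=
  ∑ p, ∑ ℓ, ‖b ℓ p - ContinuousMap.toLp 2 μ ℝ (M.β ℓ p)‖ ^ 2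

end Model

/-- The matrix `n⁻¹ ∑ᵢ Xᵢ Xᵢᵀ`. -/
def designGram {n P : ℕ} (X : Fin n → Fin P → ℝ) : Matrix (Fin P) (Fin P) ℝ :=
  (n : ℝ)⁻¹ • ∑ i, Matrix.vecMulVec (X i) (X i)

def arithMean {n : ℕ} (m : Fin n → ℕ) : ℝ := (∑ i, (m i : ℝ)) / n

def harmMean {n : ℕ} (m : Fin n → ℕ) : ℝ := n / ∑ i, (m i : ℝ)⁻¹

/-- `(n m)^{-2h/(2h+1)} + n⁻¹`, where `m` is the harmonic mean of the `m i`. -/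
def rate (h : ℝ) {n : ℕ} (m : Fin n → ℕ) : ℝ :=
  (n * harmMean m) ^ (-(2 * h) / (2 * h + 1)) + (n : ℝ)⁻¹

end FunReg

end

/-!
The lower bound is proved by a change of measure between finitely many Gaussian models. Suppose
that every `P t`, `t ∈ Θ`, has a likelihood ratio with respect to a common law `Q` whose second
moment is at most `C`, and that the events `A t` (the estimator is close to the truth `t`) overlap
at most `V`-fold. Some `A t` then has `Q`-probability at most `V / |Θ|`, hence by Cauchy–Schwarz
`P t (A t)² ≤ C V / |Θ|` (`ChiSqBound.exists_measure_sq_le`). As the probability of success has to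
tend to zero, and not only to stay away from one, `|Θ| / V` must be large compared with `C`.

In all models used, only one covariate has nonzero coefficient functions, all equal to some `f`.
The sampling law is `μ`, the error process is `ξ e₀(u)` with `ξ` Gaussian and `e₀` the first
eigenfunction, the measurement error is Gaussian, and they are compared with the model `f = 0`. The
second moment of the likelihood ratio tensorizes, and there are two ways of bounding it for one
subject.

* For `f = t e₀` the function only shifts `ξ`, and the bound `exp (x² t² / Var ξ)` does not depend
  on the number of sampling points. A large fixed number of multiples `t` with small spacing of
  order `n^{-1/2}` gives the term `n⁻¹` of the rate (`exists_parametric_lower_bound`).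
* In general, given the sampling points, `f` shifts the measurement errors, and the second moment
  is at most `exp (const · ‖f‖²)` per sampling point as long as `f` is uniformly bounded. The
  hypotheses `f = a ∑_{k ∈ S} e k`, `S ⊆ {0, …, N - 1}`, with `N ≍ (n m)^{1/(2h+1)}` and `a² ≍ 1/(n
  m)`, lie in the RKHS ball, and `C` is `exp (N / 20)` while Hamming balls of radius `N / 4` make
  up at most a fraction `(9/10)^N` of the hypercube. This gives the term `(n m)^{-2h/(2h+1)}`
  (`exists_nonparametric_lower_bound`).

The uniform bound on `f` comes from `∑ k < N, τ k * e k u ^ 2 ≤ K u u`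
(`IsEigensystem.exists_continuous`), which is Bessel's inequality in the RKHS of `K`; there the
continuous versions of the eigenfunctions are found as well.
-/

namespace FunReg

universe w

/-! ### Continuous eigenfunctions and the Mercer bound -/

/-- A feature map of the kernel, continuous because `‖φ s - φ u‖² = K s s - 2 K s u + K u u`. It
is the family of kernel functions of Mathlib's RKHS, whose kernels are operator valued: the value
`K x y` is encoded as the multiple `K x y • 1` of the identity of `ℝ`. -/
theorem IsKernel.exists_featureMap {U : Type w} [TopologicalSpace U] {K : U → U → ℝ}
    (hK : IsKernel K) :
    ∃ (H : Type w) (_ : NormedAddCommGroup H) (_ : InnerProductSpace ℝ H) (_ : CompleteSpace H)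
      (φ : U → H), Continuous φ ∧ ∀ u s, inner ℝ (φ u) (φ s) = K u s := by
  classical
  let K' : Matrix U U (ℝ →L[ℝ] ℝ) := Matrix.of fun x y => K x y • 1
  have hsymm : ∀ x y, K x y = K y x := fun x y => by
    simpa using (hK.2.1.apply y x)
  have hK' : K'.PosSemidef := by
    refine ((RKHS.posSemidef_tfae (K := K')).out 0 2).mpr ?_
    refine ⟨?_, fun vv => ?_⟩
    · ext x y
      simp [K', hsymm x y, Matrix.conjTranspose_apply]
    · have := hK.2.2 vv
      simp only [RCLike.re_to_real]
      refine this.trans_eq ?_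
      refine Finset.sum_congr rfl fun x _ => Finset.sum_congr rfl fun y _ => ?_
      simp [K', hsymm x y]
      ring
  have : Fact K'.PosSemidef := ⟨hK'⟩
  have hφ : ∀ u s, inner ℝ (RKHS.kerFun (RKHS.OfKernel K') u (1 : ℝ))
      (RKHS.kerFun (RKHS.OfKernel K') s (1 : ℝ)) = K u s := by
    intro u s
    rw [← RKHS.kernel_inner, RKHS.OfKernel.kernel_ofKernel]
    simp [K', hsymm u s]
  refine ⟨RKHS.OfKernel K', inferInstance, inferInstance, inferInstance,
    fun u => RKHS.kerFun (RKHS.OfKernel K') u (1 : ℝ), ?_, hφ⟩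
  rw [continuous_iff_continuousAt]
  intro u
  rw [ContinuousAt, tendsto_iff_norm_sub_tendsto_zero]
  have h1 : ∀ s, ‖RKHS.kerFun (RKHS.OfKernel K') s (1 : ℝ)
      - RKHS.kerFun (RKHS.OfKernel K') u (1 : ℝ)‖ = √(K s s - 2 * K s u + K u u) := by
    intro s
    rw [← Real.sqrt_sq (norm_nonneg _), @norm_sub_sq_real, ← real_inner_self_eq_norm_sq,
      ← real_inner_self_eq_norm_sq, hφ, hφ, hφ]
  simp_rw [h1]
  have h2 : Continuous fun s => √(K s s - 2 * K s u + K u u) := by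
    have a : Continuous fun s => K s s := hK.1.comp (continuous_id.prodMk continuous_id)
    have b : Continuous fun s => K s u := hK.1.comp (continuous_id.prodMk continuous_const)
    exact Real.continuous_sqrt.comp ((a.sub (b.const_mul 2)).add continuous_const)
  have := h2.tendsto u
  simpa [show K u u - 2 * K u u + K u u = 0 by ring] using this

/-- The eigenfunctions have continuous versions `e k`, and these obey the Mercer bound. In the
RKHS with feature map `φ`, the vectors `Ψ k = ∫ v k s • φ s` are orthogonal with
`‖Ψ k‖² = τ k`, and `e k u = ⟪φ u, Ψ k⟫ / τ k`; the bound is Bessel's inequality for `φ u`. -/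
theorem IsEigensystem.exists_continuous {U : Type w} [TopologicalSpace U] [CompactSpace U]
    [MeasurableSpace U] [BorelSpace U] {K : U → U → ℝ} (hK : IsKernel K)
    {μ : Measure U} [IsFiniteMeasure μ] {τ : ℕ → ℝ} {v : ℕ → Lp ℝ 2 μ}
    (hτv : IsEigensystem K μ τ v) :
    ∃ e : ℕ → C(U, ℝ), (∀ k, ContinuousMap.toLp 2 μ ℝ (e k) = v k) ∧
      ∀ N u, ∑ k ∈ Finset.range N, τ k * (e k u) ^ 2 ≤ K u u := by
  obtain ⟨H, _, _, _, φ, hφc, hφ⟩ := hK.exists_featureMap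
  obtain ⟨B, hB⟩ : ∃ B, ∀ u, ‖φ u‖ ≤ B := by
    obtain ⟨B, hB⟩ := (isCompact_range hφc).isBounded.exists_norm_le
    exact ⟨B, fun u => hB _ ⟨u, rfl⟩⟩
  have hφm : AEStronglyMeasurable φ μ := hφc.aestronglyMeasurable_of_compactSpace
  have hint : ∀ k, Integrable (fun s => v k s • φ s) μ := fun k => by
    have := (Lp.memLp (v k)).integrable (by norm_num)
    exact this.smul_bdd B hφm (Eventually.of_forall hB)
  set Ψ : ℕ → H := fun k => ∫ s, v k s • φ s ∂μ with hΨ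
  have h1 : ∀ u k, inner ℝ (φ u) (Ψ k) = ∫ s, K u s * v k s ∂μ := by
    intro u k
    rw [hΨ, ← integral_inner (hint k)]
    simp [inner_smul_right, hφ, mul_comm]
  have h2 : ∀ k l, inner ℝ (Ψ k) (Ψ l) = if k = l then τ k else 0 := by
    intro k l
    have : inner ℝ (Ψ k) (Ψ l) = ∫ s, v k s * (τ l * v l s) ∂μ := by
      rw [real_inner_comm]
      conv_lhs => rw [hΨ]
      simp only
      rw [← integral_inner (hint k)]
      refine integral_congr_ae ?_
      filter_upwards [hτv.eigen l] with u hu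
      rw [inner_smul_right, real_inner_comm, h1, hu]
    rw [this]
    have h3 := orthonormal_iff_ite.mp hτv.orthonormal k l
    rw [L2.inner_def] at h3
    have : ∀ s, v k s * (τ l * v l s) = τ l * inner ℝ (v k s) (v l s) := fun s => by
      simp; ring
    simp_rw [this]
    rw [integral_const_mul, h3]
    split_ifs with hkl <;> simp [hkl]
  have hc : ∀ k, Continuous fun u => (τ k)⁻¹ * inner ℝ (φ u) (Ψ k) := fun k => by fun_prop
  refine ⟨fun k => ⟨_, hc k⟩, fun k => ?_, fun N u => ?_⟩
  · apply Lp.ext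
    refine (ContinuousMap.coeFn_toLp μ _).trans ?_
    filter_upwards [hτv.eigen k] with u hu
    have := (hτv.pos k).ne'
    simp only [ContinuousMap.coe_mk, h1, hu]
    field_simp
  · have hon : Orthonormal ℝ fun k => (√(τ k))⁻¹ • Ψ k := by
      rw [orthonormal_iff_ite]
      intro k l
      rw [inner_smul_left, inner_smul_right, h2]
      split_ifs with hkl
      · subst hkl
        have := Real.sqrt_pos.mpr (hτv.pos k)
        have h5 := Real.sq_sqrt (hτv.pos k).le
        simp only [conj_trivial]
        field_simp
        exact h5.symm
      · simp
    have := hon.sum_inner_products_le (x := φ u) (s := Finset.range N)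
    rw [← real_inner_self_eq_norm_sq, hφ] at this
    refine le_trans (le_of_eq (Finset.sum_congr rfl fun k _ => ?_)) this
    have h4 := Real.sqrt_pos.mpr (hτv.pos k)
    have h5 := Real.sq_sqrt (hτv.pos k).le
    have h6 := hτv.pos k
    rw [inner_smul_left, real_inner_comm]
    simp only [ContinuousMap.coe_mk, conj_trivial, Real.norm_eq_abs, sq_abs]
    rw [mul_pow, mul_pow, inv_pow, inv_pow, h5]
    field_simp

/-- Elements of the RKHS are bounded by their RKHS norm, times the square root of the diagonal of
the kernel. -/
theorem sum_smul_apply_sq_le {U : Type w} [TopologicalSpace U] {K : U → U → ℝ} {τ : ℕ → ℝ}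
    {e : ℕ → C(U, ℝ)} (hτ : ∀ k, 0 < τ k)
    (heK : ∀ N u, ∑ k ∈ Finset.range N, τ k * (e k u) ^ 2 ≤ K u u) {N : ℕ} (a : Fin N → ℝ)
    (u : U) : (∑ k, a k • e k : C(U, ℝ)) u ^ 2 ≤ (∑ k, a k ^ 2 / τ k) * K u u := by
  have h1 := heK N u
  rw [Finset.sum_range] at h1
  have h2 := Finset.sum_sq_le_sum_mul_sum_of_sq_le_mul Finset.univ
    (r := fun k : Fin N => a k * e k u) (f := fun k => a k ^ 2 / τ k)
    (g := fun k => τ k * e k u ^ 2) (fun k _ => div_nonneg (sq_nonneg _) (hτ k).le)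
    (fun k _ => mul_nonneg (hτ k).le (sq_nonneg _)) fun k _ => by
      have := (hτ k).ne'
      refine le_of_eq ?_
      field_simp
  have h3 : (∑ k, a k • e k : C(U, ℝ)) u = ∑ k, a k * e k u := by
    simp [ContinuousMap.sum_apply]
  rw [h3]
  refine h2.trans ?_
  gcongr
  exact Finset.sum_nonneg fun k _ => div_nonneg (sq_nonneg _) (hτ k).le

/-! ### Second moments of likelihood ratios -/

/-- Cauchy–Schwarz for `g = √(c G)`, without square roots. -/
theorem sq_lintegral_le_of_sq_le {α : Type*} [MeasurableSpace α] {μ : Measure α} {g c G : α → ℝ≥0∞}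
    (hc : Measurable c) (hG : Measurable G) (h : ∀ a, g a ^ 2 ≤ c a * G a) :
    (∫⁻ a, g a ∂μ) ^ 2 ≤ (∫⁻ a, c a ∂μ) * ∫⁻ a, G a ∂μ := by
  have key := ENNReal.lintegral_mul_le_Lp_mul_Lq μ Real.HolderConjugate.two_two
    (f := fun a => c a ^ (1 / 2 : ℝ)) (g := fun a => G a ^ (1 / 2 : ℝ))
    (hc.pow_const _).aemeasurable (hG.pow_const _).aemeasurable
  have h2 : ∀ x : ℝ≥0∞, (x ^ (1 / 2 : ℝ)) ^ (2 : ℝ) = x := fun x => by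
    rw [← ENNReal.rpow_mul]; norm_num
  have h3 : ∀ x : ℝ≥0∞, (x ^ (1 / 2 : ℝ)) ^ 2 = x := fun x => by
    rw [← ENNReal.rpow_natCast]; exact_mod_cast h2 x
  simp only [h2, Pi.mul_apply] at key
  have h1 : ∫⁻ a, g a ∂μ ≤ ∫⁻ a, c a ^ (1 / 2 : ℝ) * G a ^ (1 / 2 : ℝ) ∂μ := by
    refine lintegral_mono fun a => ?_
    rw [← ENNReal.mul_rpow_of_nonneg _ _ (by norm_num)]
    refine le_trans (le_of_eq ?_) (ENNReal.rpow_le_rpow (h a) (by norm_num))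
    rw [← ENNReal.rpow_natCast, ← ENNReal.rpow_mul]; norm_num
  calc (∫⁻ a, g a ∂μ) ^ 2
      ≤ ((∫⁻ a, c a ∂μ) ^ (1 / 2 : ℝ) * (∫⁻ a, G a ∂μ) ^ (1 / 2 : ℝ)) ^ 2 := by
        gcongr; exact h1.trans key
    _ = _ := by rw [mul_pow, h3, h3]

/-- `P` has a likelihood ratio with respect to `Q` whose second moment under `Q` is at most `C`,
i.e. the `χ²`-divergence of `P` from `Q` is at most `C - 1`. The dual formulation used here avoids
densities, and passes at once to images and products. -/
def ChiSqBound {α : Type*} [MeasurableSpace α] (P Q : Measure α) (C : ℝ≥0∞) : Prop :=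
  ∀ F : α → ℝ≥0∞, Measurable F → (∫⁻ a, F a ∂P) ^ 2 ≤ C * ∫⁻ a, F a ^ 2 ∂Q

namespace ChiSqBound

variable {α β : Type*} [MeasurableSpace α] [MeasurableSpace β]

theorem refl (P : Measure α) [IsProbabilityMeasure P] : ChiSqBound P P 1 := fun F hF => by
  simpa using sq_lintegral_le_of_sq_le (μ := P) (c := fun _ => 1) (G := fun a => F a ^ 2)
    measurable_const (hF.pow_const 2) (g := F) (by simp)

theorem mono {P Q : Measure α} {C C' : ℝ≥0∞} (h : ChiSqBound P Q C) (hC : C ≤ C') :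
    ChiSqBound P Q C' := fun F hF => (h F hF).trans (by gcongr)

theorem map {P Q : Measure α} {C : ℝ≥0∞} (h : ChiSqBound P Q C) {f : α → β} (hf : Measurable f) :
    ChiSqBound (P.map f) (Q.map f) C := fun F hF => by
  rw [lintegral_map hF hf, lintegral_map (hF.pow_const 2) hf]
  exact h _ (hF.comp hf)

theorem prod {P Q : Measure α} {P' Q' : Measure β} {C C' : ℝ≥0∞} [SFinite P'] [SFinite Q']
    (h : ChiSqBound P Q C) (h' : ChiSqBound P' Q' C') :
    ChiSqBound (P.prod P') (Q.prod Q') (C * C') := fun F hF => by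
  rw [lintegral_prod _ hF.aemeasurable, lintegral_prod _ (hF.pow_const 2).aemeasurable]
  refine (h _ hF.lintegral_prod_right').trans ?_
  rw [mul_assoc]
  gcongr
  rw [← lintegral_const_mul _ (hF.pow_const 2).lintegral_prod_right']
  exact lintegral_mono fun a => h' _ (hF.comp measurable_prodMk_left)

/-- Transforming the second coordinate by a map that depends on the first coordinate: the
second moments are averaged. -/
theorem mixture {μ : Measure α} {D : Measure β} [SFinite μ] [SFinite D] {T : α → β → β}
    (hT : Measurable fun q : α × β => T q.1 q.2) {C : α → ℝ≥0∞} (hC : Measurable C)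
    (h : ∀ a, ChiSqBound (D.map (T a)) D (C a)) :
    ChiSqBound ((μ.prod D).map fun q => (q.1, T q.1 q.2)) (μ.prod D) (∫⁻ a, C a ∂μ) :=
  fun F hF => by
    have hT' : Measurable fun q : α × β => (q.1, T q.1 q.2) := measurable_fst.prodMk hT
    rw [lintegral_map hF hT',
      lintegral_prod (fun q : α × β => F (q.1, T q.1 q.2)) (hF.comp hT').aemeasurable,
      lintegral_prod _ (hF.pow_const 2).aemeasurable]
    refine sq_lintegral_le_of_sq_le hC (hF.pow_const 2).lintegral_prod_right' fun a => ?_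
    have hFa : Measurable fun b => F (a, b) := hF.comp measurable_prodMk_left
    have hTa : Measurable (T a) := hT.comp measurable_prodMk_left
    have := h a _ hFa
    rwa [lintegral_map hFa hTa] at this

theorem pi {n : ℕ} {Ω : Fin n → Type*} [∀ i, MeasurableSpace (Ω i)]
    {P Q : (i : Fin n) → Measure (Ω i)} [∀ i, SigmaFinite (P i)] [∀ i, SigmaFinite (Q i)]
    {C : Fin n → ℝ≥0∞} (h : ∀ i, ChiSqBound (P i) (Q i) (C i)) :
    ChiSqBound (Measure.pi P) (Measure.pi Q) (∏ i, C i) := by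
  induction n with
  | zero =>
    simp only [Measure.pi_of_empty P, Measure.pi_of_empty Q]
    simpa using refl _
  | succ n ih =>
    have hP := (measurePreserving_piFinSuccAbove P 0).symm.map_eq
    have hQ := (measurePreserving_piFinSuccAbove Q 0).symm.map_eq
    rw [← hP, ← hQ, Fin.prod_univ_succ]
    exact ((h 0).prod (ih fun j => h (Fin.succAbove 0 j))).map (MeasurableEquiv.measurable _)

/-- A change of measure for finitely many hypotheses: if `t` ranges over `Θ` and no observation
lies in more than `V` of the sets `A t`, then one of the `A t` is unlikely under its own `P t`,
because it is so under `Q` by averaging. -/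
theorem exists_measure_sq_le {Θ : Type*} [Fintype Θ] [Nonempty Θ] {Q : Measure α}
    [IsProbabilityMeasure Q] {P : Θ → Measure α} {C : ℝ≥0∞} (h : ∀ t, ChiSqBound (P t) Q C)
    {A : Θ → Set α} (hA : ∀ t, MeasurableSet (A t)) {V : ℝ≥0∞}
    (hV : ∀ x, ∑ t, (A t).indicator 1 x ≤ V) :
    ∃ t, (P t (A t)) ^ 2 ≤ C * (V / Fintype.card Θ) := by
  have hsum : ∑ t, Q (A t) ≤ V := by
    calc ∑ t, Q (A t) = ∑ t, ∫⁻ x, (A t).indicator 1 x ∂Q := by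
          simp only [lintegral_indicator_one (hA _)]
      _ = ∫⁻ x, ∑ t, (A t).indicator 1 x ∂Q :=
          (lintegral_finsetSum _ fun t _ => measurable_one.indicator (hA t)).symm
      _ ≤ ∫⁻ _, V ∂Q := lintegral_mono hV
      _ = V := by simp
  obtain ⟨t, ht⟩ : ∃ t, Q (A t) ≤ V / Fintype.card Θ := by
    by_contra! hcon
    have hcard : (Fintype.card Θ : ℝ≥0∞) ≠ 0 := by simp
    have : V < ∑ t, Q (A t) := by
      calc V = ∑ _t : Θ, V / Fintype.card Θ := by
            rw [Finset.sum_const, Finset.card_univ, nsmul_eq_mul,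
              ENNReal.mul_div_cancel hcard (ENNReal.natCast_ne_top _)]
        _ < ∑ t, Q (A t) := ENNReal.sum_lt_sum_of_nonempty Finset.univ_nonempty fun t _ => hcon t
    exact absurd hsum this.not_ge
  refine ⟨t, ?_⟩
  have := h t ((A t).indicator 1) (measurable_one.indicator (hA t))
  have hsq : ∀ x, ((A t).indicator (1 : α → ℝ≥0∞) x) ^ 2 = (A t).indicator 1 x := fun x => by
    by_cases hx : x ∈ A t <;> simp [hx]
  simp only [hsq, lintegral_indicator_one (hA t)] at this
  exact this.trans (by gcongr)

end ChiSqBound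

/-- The likelihood ratio of `N(s, σ)` with respect to `N(0, σ)` is `exp (s y / σ - s² / (2 σ))`; its
second moment is a value of the Gaussian moment generating function. -/
theorem chiSqBound_gaussianReal_map_add (s : ℝ) {σ : NNReal} (hσ : σ ≠ 0) :
    ChiSqBound ((gaussianReal 0 σ).map (· + s)) (gaussianReal 0 σ)
      (ENNReal.ofReal (Real.exp (s ^ 2 / σ))) := by
  have hσ' : (σ : ℝ) ≠ 0 := by exact_mod_cast hσ
  rw [gaussianReal_map_add_const, zero_add]
  set f : ℝ → ℝ≥0∞ := fun y => ENNReal.ofReal (Real.exp (s * y / σ - s ^ 2 / (2 * σ))) with hf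
  have hfm : Measurable f := by fun_prop
  have h1 : gaussianReal s σ = (gaussianReal 0 σ).withDensity f := by
    rw [gaussianReal_of_var_ne_zero _ hσ, gaussianReal_of_var_ne_zero _ hσ,
      ← withDensity_mul _ (measurable_gaussianPDF _ _) hfm]
    congr 1
    funext y
    simp only [Pi.mul_apply, gaussianPDF, hf]
    rw [← ENNReal.ofReal_mul (gaussianPDFReal_nonneg _ _ _)]
    congr 1
    rw [gaussianPDFReal, gaussianPDFReal, mul_assoc _ (Real.exp _), ← Real.exp_add]
    congr 2
    field_simp
    ring
  have h2 : ∫⁻ y, f y ^ 2 ∂(gaussianReal 0 σ) = ENNReal.ofReal (Real.exp (s ^ 2 / σ)) := by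
    have h3 : ∀ y, f y ^ 2
        = ENNReal.ofReal (Real.exp (2 * s / σ * y)) * ENNReal.ofReal (Real.exp (-(s ^ 2 / σ))) := by
      intro y
      simp only [hf]
      rw [← ENNReal.ofReal_pow (Real.exp_nonneg _), ← ENNReal.ofReal_mul (Real.exp_nonneg _),
        ← Real.exp_nat_mul, ← Real.exp_add]
      congr 2
      push_cast
      field_simp
      ring
    simp_rw [h3]
    rw [lintegral_mul_const _ (by fun_prop), ← ofReal_integral_eq_lintegral_ofReal
      (integrable_exp_mul_gaussianReal _) (Eventually.of_forall fun _ => Real.exp_nonneg _),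
      ← ENNReal.ofReal_mul (integral_nonneg fun _ => Real.exp_nonneg _)]
    have h4 := congrFun (mgf_id_gaussianReal (μ := 0) (v := σ)) (2 * s / σ)
    simp only [mgf, id] at h4
    rw [h4, ← Real.exp_add]
    congr 2
    field_simp
    ring
  intro F hF
  rw [h1, lintegral_withDensity_eq_lintegral_mul _ hfm hF, ← h2]
  exact sq_lintegral_le_of_sq_le (hfm.pow_const 2) (hF.pow_const 2)
    fun a => by rw [Pi.mul_apply, mul_pow]

/-! ### Gaussian models -/

/-- The Gaussian model in which only the coefficients of the covariate `p₀` are present: they all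
equal `f`, the sampling points have law `μ`, the error process is `ξ φ(u)` with
`ξ ∼ N(0, vE)` and the measurement error is `z ∼ N(0, vD)`, both common to all `ℓ`. All `L`
responses coincide, so that the data amount to a scalar regression. -/
noncomputable def gaussianModel {U : Type w} [TopologicalSpace U] (L : ℕ) {P : ℕ} (p₀ : Fin P)
    (φ : C(U, ℝ)) (vE vD : NNReal) (f : C(U, ℝ)) : Model U L P where
  β := fun _ p => if p = p₀ then f else 0
  ρ := fun _ => 1
  E := ℝ
  mE := inferInstance
  Q := gaussianReal 0 vE
  ε := fun e _ u => e * φ u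
  D := (gaussianReal 0 vD).map fun z _ => z

section

variable {U : Type w} [TopologicalSpace U] [MeasurableSpace U] {L P : ℕ} {p₀ : Fin P}
  {φ : C(U, ℝ)} {vE vD : NNReal}

@[simp]
theorem gaussianModel_pointLaw (μ : Measure U) (f : C(U, ℝ)) :
    (gaussianModel L p₀ φ vE vD f).pointLaw μ = μ := by
  simp [Model.pointLaw, gaussianModel]

/-- The observations of one subject in the Gaussian model, as a function of the error variable,
the sampling points and the measurement errors; `x` is the value of the relevant covariate. -/
def gaussianObserve (φ f : C(U, ℝ)) (x : ℝ) {L m : ℕ}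
    (ω : ℝ × (Fin m → U) × (Fin m → Fin L → ℝ)) : Fin m → U × (Fin L → ℝ) :=
  fun j => (ω.2.1 j, fun ℓ => x * f (ω.2.1 j) + ω.1 * φ (ω.2.1 j) + ω.2.2 j ℓ)

theorem subjectLaw_gaussianModel (f : C(U, ℝ)) (μ : Measure U) (x : Fin P → ℝ) (m : ℕ) :
    (gaussianModel L p₀ φ vE vD f).subjectLaw μ x m =
      ((gaussianReal 0 vE).prod ((Measure.pi fun _ : Fin m => μ).prod (Measure.pi fun _ : Fin m =>
        (gaussianReal 0 vD).map fun (z : ℝ) (_ : Fin L) => z))).map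
          (gaussianObserve φ f (x p₀)) := by
  have hobs : (gaussianModel L p₀ φ vE vD f).observe x (m := m) = gaussianObserve φ f (x p₀) := by
    funext ω j
    simp only [Model.observe, gaussianObserve]
    congr 1
    funext ℓ
    congr 2
    rw [Finset.sum_eq_single p₀] <;> simp +contextual [gaussianModel]
  rw [Model.subjectLaw, gaussianModel_pointLaw, hobs]
  rfl

variable [BorelSpace U]

theorem measurable_gaussianObserve (φ f : C(U, ℝ)) (x : ℝ) (L m : ℕ) :
    Measurable (gaussianObserve φ f x (L := L) (m := m)) := by
  refine measurable_pi_iff.mpr fun j => Measurable.prodMk ?_ (measurable_pi_iff.mpr fun ℓ => ?_)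
  · fun_prop
  · have hu : Measurable fun ω : ℝ × (Fin m → U) × (Fin m → Fin L → ℝ) => ω.2.1 j := by fun_prop
    have hd : Measurable fun ω : ℝ × (Fin m → U) × (Fin m → Fin L → ℝ) => ω.2.2 j ℓ := by fun_prop
    exact (((f.measurable.comp hu).const_mul _).add
      (measurable_fst.mul (φ.measurable.comp hu))).add hd

variable [CompactSpace U]

theorem gaussianModel_admissible {μ : Measure U} [IsProbabilityMeasure μ]
    {τ : ℕ → ℝ} {v : ℕ → Lp ℝ 2 μ} {M₀ c C Mε Mδ : ℝ} (hc1 : c ≤ 1) (hC : 1 ≤ C)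
    (hE : ∀ u, φ u ^ 2 * vE ≤ Mε) (hD : vD ≤ Mδ) {f : C(U, ℝ)} (hf : f ∈ rkhsBall μ τ v M₀) :
    (gaussianModel L p₀ φ vE vD f).Admissible μ τ v M₀ c C Mε Mδ := by
  have hconst : Measurable fun (z : ℝ) (_ : Fin L) => z :=
    measurable_pi_iff.mpr fun _ => measurable_id
  have hid : MemLp (fun x : ℝ => x) 2 (gaussianReal 0 vE) :=
    memLp_id_gaussianReal' 2 (by norm_num)
  constructor
  case β_mem =>
    intro ℓ p
    simp only [gaussianModel]
    split_ifs
    · exact hf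
    · simp [rkhsBall, rkhsNormSq]
  case ρ_meas => exact measurable_const
  case ρ_bounds => exact Eventually.of_forall fun _ => ⟨hc1, hC⟩
  case ρ_prob => rw [gaussianModel_pointLaw]; infer_instance
  case Q_prob => exact inferInstanceAs (IsProbabilityMeasure (gaussianReal 0 vE))
  case ε_meas =>
    intro ℓ
    exact measurable_fst.mul (φ.continuous.measurable.comp measurable_snd)
  case ε_path =>
    intro ℓ
    refine Eventually.of_forall fun (e : ℝ) => ?_
    change MemLp (fun u => e * φ u) 2 μ
    exact (memLp_top_of_bound (φ.continuous.measurable.const_mul e).aestronglyMeasurable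
      (‖e‖ * ‖φ‖) (Eventually.of_forall fun u => by
        simpa using mul_le_mul_of_nonneg_left (φ.norm_coe_le_norm u) (norm_nonneg e))).mono_exponent
          le_top
  case ε_sq =>
    intro ℓ u
    exact hid.mul_const (φ u)
  case ε_mean =>
    intro ℓ u
    change ∫ e, e * φ u ∂(gaussianReal 0 vE) = 0
    rw [integral_mul_const, integral_id_gaussianReal, zero_mul]
  case ε_var =>
    intro ℓ u
    change variance (fun e => e * φ u) (gaussianReal 0 vE) ≤ Mε
    rw [variance_mul_const, variance_fun_id_gaussianReal]
    linarith [hE u]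
  case D_prob =>
    exact Measure.isProbabilityMeasure_map hconst.aemeasurable
  case δ_sq =>
    intro ℓ
    change MemLp (fun d : Fin L → ℝ => d ℓ) 2 ((gaussianReal 0 vD).map fun z _ => z)
    rw [memLp_map_measure_iff (measurable_pi_apply ℓ).aestronglyMeasurable hconst.aemeasurable]
    exact memLp_id_gaussianReal' 2 (by norm_num)
  case δ_mean =>
    intro ℓ
    change ∫ d, d ℓ ∂((gaussianReal 0 vD).map fun z _ => z) = 0
    rw [integral_map hconst.aemeasurable (measurable_pi_apply ℓ).aestronglyMeasurable,
      integral_id_gaussianReal]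
  case δ_var =>
    intro ℓ
    change variance (fun d : Fin L → ℝ => d ℓ) ((gaussianReal 0 vD).map fun z _ => z) ≤ Mδ
    rw [variance_map (measurable_pi_apply ℓ).aemeasurable hconst.aemeasurable]
    change variance (fun z : ℝ => z) (gaussianReal 0 vD) ≤ Mδ
    rw [variance_fun_id_gaussianReal]
    exact hD

instance (f : C(U, ℝ)) (μ : Measure U) [IsProbabilityMeasure μ] (x : Fin P → ℝ) (m : ℕ) :
    IsProbabilityMeasure ((gaussianModel L p₀ φ vE vD f).subjectLaw μ x m) := by
  have hconst : Measurable fun (z : ℝ) (_ : Fin L) => z :=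
    measurable_pi_iff.mpr fun _ => measurable_id
  have : IsProbabilityMeasure ((gaussianReal 0 vD).map fun (z : ℝ) (_ : Fin L) => z) :=
    Measure.isProbabilityMeasure_map hconst.aemeasurable
  rw [subjectLaw_gaussianModel]
  exact Measure.isProbabilityMeasure_map (measurable_gaussianObserve φ f _ L m).aemeasurable

instance (f : C(U, ℝ)) (μ : Measure U) [IsProbabilityMeasure μ] {n : ℕ} (X : Fin n → Fin P → ℝ)
    (m : Fin n → ℕ) :
    IsProbabilityMeasure ((gaussianModel L p₀ φ vE vD f).sampleLaw μ X m) := by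
  unfold Model.sampleLaw; infer_instance

/-- When `f = t • φ`, the regression function only shifts the error process, so the number of
sampling points does not enter. -/
theorem chiSqBound_subjectLaw_smul {μ : Measure U} [IsProbabilityMeasure μ] (hE : vE ≠ 0) (t : ℝ)
    (x : Fin P → ℝ) (m : ℕ) :
    ChiSqBound ((gaussianModel L p₀ φ vE vD (t • φ)).subjectLaw μ x m)
      ((gaussianModel L p₀ φ vE vD 0).subjectLaw μ x m)
      (ENNReal.ofReal (Real.exp ((x p₀ * t) ^ 2 / vE))) := by
  have hconst : Measurable fun (z : ℝ) (_ : Fin L) => z :=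
    measurable_pi_iff.mpr fun _ => measurable_id
  have : IsProbabilityMeasure ((gaussianReal 0 vD).map fun (z : ℝ) (_ : Fin L) => z) :=
    Measure.isProbabilityMeasure_map hconst.aemeasurable
  rw [subjectLaw_gaussianModel, subjectLaw_gaussianModel]
  set R := (Measure.pi fun _ : Fin m => μ).prod (Measure.pi fun _ : Fin m =>
        (gaussianReal 0 vD).map fun (z : ℝ) (_ : Fin L) => z)
  have h0 := measurable_gaussianObserve φ 0 (x p₀) L m
  have key := (((chiSqBound_gaussianReal_map_add (x p₀ * t) hE).prod
    (ChiSqBound.refl R)).map h0)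
  rw [mul_one] at key
  convert key using 1
  conv_rhs => rw [← Measure.map_id (μ := R)]
  rw [Measure.map_prod_map _ _ (by fun_prop) measurable_id,
    Measure.map_map h0 (by fun_prop)]
  congr 1
  funext ω j
  refine Prod.ext rfl (funext fun ℓ => ?_)
  simp [gaussianObserve]
  ring

/-- For general `f`, conditionally on the error process and the sampling points the regression
function shifts the measurement errors; averaging over the sampling points gives the bound. -/
theorem chiSqBound_subjectLaw {μ : Measure U} [IsProbabilityMeasure μ] (hD : vD ≠ 0)
    (f : C(U, ℝ)) (x : Fin P → ℝ) (m : ℕ) :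
    ChiSqBound ((gaussianModel L p₀ φ vE vD f).subjectLaw μ x m)
      ((gaussianModel L p₀ φ vE vD 0).subjectLaw μ x m)
      (ENNReal.ofReal ((∫ u, Real.exp ((x p₀ * f u) ^ 2 / vD) ∂μ) ^ m)) := by
  have hconst : Measurable fun (z : ℝ) (_ : Fin L) => z :=
    measurable_pi_iff.mpr fun _ => measurable_id
  rw [subjectLaw_gaussianModel, subjectLaw_gaussianModel]
  set D := (gaussianReal 0 vD).map fun (z : ℝ) (_ : Fin L) => z with hDdef
  have : IsProbabilityMeasure D :=
    Measure.isProbabilityMeasure_map hconst.aemeasurable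
  have h0 := measurable_gaussianObserve φ 0 (x p₀) L m
  have hshift : ∀ s : ℝ, ChiSqBound (D.map fun d ℓ => d ℓ + s) D
      (ENNReal.ofReal (Real.exp (s ^ 2 / vD))) := fun s => by
    have := (chiSqBound_gaussianReal_map_add s hD).map hconst
    rw [Measure.map_map hconst (by fun_prop)] at this
    rw [hDdef, Measure.map_map (by fun_prop) hconst]
    exact this
  have hadd : ∀ s : ℝ, Measurable fun (d : Fin L → ℝ) ℓ => d ℓ + s := fun s => by fun_prop
  let T : (Fin m → U) → (Fin m → Fin L → ℝ) → (Fin m → Fin L → ℝ) :=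
    fun u d j ℓ => d j ℓ + x p₀ * f (u j)
  have hT : Measurable fun q : (Fin m → U) × (Fin m → Fin L → ℝ) => T q.1 q.2 := by
    refine measurable_pi_iff.mpr fun j => measurable_pi_iff.mpr fun ℓ => Measurable.add ?_ ?_
    · fun_prop
    · exact (f.measurable.comp (by fun_prop)).const_mul _
  have hTC : ∀ u, ChiSqBound ((Measure.pi fun _ : Fin m => D).map (T u))
      (Measure.pi fun _ : Fin m => D)
      (∏ j, ENNReal.ofReal (Real.exp ((x p₀ * f (u j)) ^ 2 / vD))) := fun u => by
    have hs : ∀ j : Fin m, IsProbabilityMeasure (D.map fun d ℓ => d ℓ + x p₀ * f (u j)) :=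
      fun j => Measure.isProbabilityMeasure_map (hadd _).aemeasurable
    have := ChiSqBound.pi (P := fun j : Fin m => D.map fun d ℓ => d ℓ + x p₀ * f (u j))
      (Q := fun _ => D) (fun j => hshift (x p₀ * f (u j)))
    rwa [← Measure.pi_map_pi (fun j => (hadd _).aemeasurable)] at this
  have hCm : Measurable fun u : Fin m → U =>
      ∏ j, ENNReal.ofReal (Real.exp ((x p₀ * f (u j)) ^ 2 / vD)) := by
    refine Finset.measurable_prod _ fun j _ => ?_
    have : Measurable fun u : Fin m → U => f (u j) := f.measurable.comp (by fun_prop)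
    fun_prop
  have key := ((ChiSqBound.refl (gaussianReal 0 vE)).prod
    (ChiSqBound.mixture (μ := Measure.pi fun _ : Fin m => μ) hT hCm hTC)).map h0
  rw [one_mul] at key
  have hexpc : Continuous fun u => Real.exp ((x p₀ * f u) ^ 2 / vD) := by fun_prop
  have hint : ∫⁻ u, ∏ j, ENNReal.ofReal (Real.exp ((x p₀ * f (u j)) ^ 2 / vD))
      ∂(Measure.pi fun _ : Fin m => μ)
      = ENNReal.ofReal ((∫ u, Real.exp ((x p₀ * f u) ^ 2 / vD) ∂μ) ^ m) := by
    have h1 : Integrable (fun u : Fin m → U => ∏ j, Real.exp ((x p₀ * f (u j)) ^ 2 / vD))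
        (Measure.pi fun _ : Fin m => μ) :=
      Integrable.fintype_prod (f := fun _ : Fin m => fun u => Real.exp ((x p₀ * f u) ^ 2 / vD))
        fun _ => hexpc.integrable_of_hasCompactSupport (HasCompactSupport.of_compactSpace _)
    simp_rw [← ENNReal.ofReal_prod_of_nonneg fun (j : Fin m) (_ : j ∈ Finset.univ) =>
      Real.exp_nonneg _]
    rw [← ofReal_integral_eq_lintegral_ofReal h1
      (Eventually.of_forall fun _ => Finset.prod_nonneg fun _ _ => Real.exp_nonneg _),
      integral_fintype_prod_eq_pow (f := fun u => Real.exp ((x p₀ * f u) ^ 2 / vD))]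
    simp
  rw [hint] at key
  convert key using 1
  conv_rhs => rw [← Measure.map_id (μ := gaussianReal 0 vE)]
  rw [Measure.map_prod_map _ _ measurable_id (measurable_fst.prodMk hT),
    Measure.map_map h0 (measurable_id.prodMap (measurable_fst.prodMk hT))]
  congr 1
  funext ω j
  refine Prod.ext rfl (funext fun ℓ => ?_)
  simp [gaussianObserve, T]
  ring

end

/-! ### The whole sample and testing -/

section

variable {U : Type w} [TopologicalSpace U] [CompactSpace U] [MeasurableSpace U] [BorelSpace U]
  {L P : ℕ} {p₀ : Fin P} {φ : C(U, ℝ)} {vE vD : NNReal}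

theorem chiSqBound_sampleLaw_smul {μ : Measure U} [IsProbabilityMeasure μ] (hE : vE ≠ 0)
    {ζ : ℝ} {n : ℕ} {X : Fin n → Fin P → ℝ} (hX : ∀ i p, |X i p| ≤ ζ) (m : Fin n → ℕ) (t : ℝ) :
    ChiSqBound ((gaussianModel L p₀ φ vE vD (t • φ)).sampleLaw μ X m)
      ((gaussianModel L p₀ φ vE vD 0).sampleLaw μ X m)
      (ENNReal.ofReal (Real.exp (n * (ζ ^ 2 * t ^ 2 / vE)))) := by
  refine (ChiSqBound.pi fun i => chiSqBound_subjectLaw_smul hE t (X i) (m i)).mono ?_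
  rw [← ENNReal.ofReal_prod_of_nonneg fun _ _ => Real.exp_nonneg _, ← Real.exp_sum]
  refine ENNReal.ofReal_le_ofReal (Real.exp_le_exp.mpr ?_)
  refine (Finset.sum_le_card_nsmul _ _ (ζ ^ 2 * t ^ 2 / vE) fun i _ => ?_).trans_eq (by simp)
  rw [mul_pow]
  have := sq_le_sq' (abs_le.mp (hX i p₀)).1 (abs_le.mp (hX i p₀)).2
  gcongr

/-- For bounded `f` the exponential moment of `f²` is controlled by the `L²` norm, through
`exp y ≤ 1 + y exp B` for `0 ≤ y ≤ B`. -/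
theorem integral_exp_sq_le {μ : Measure U} [IsProbabilityMeasure μ] {f : C(U, ℝ)} {c B : ℝ}
    (hc : 0 ≤ c) (hB : ∀ u, c * f u ^ 2 ≤ B) :
    ∫ u, Real.exp (c * f u ^ 2) ∂μ ≤ Real.exp (c * Real.exp B * ∫ u, f u ^ 2 ∂μ) := by
  have hint : ∀ g : U → ℝ, Continuous g → Integrable g μ := fun g hg =>
    hg.integrable_of_hasCompactSupport (HasCompactSupport.of_compactSpace _)
  calc ∫ u, Real.exp (c * f u ^ 2) ∂μ
      ≤ ∫ u, (1 + c * Real.exp B * f u ^ 2) ∂μ := by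
        refine integral_mono (hint _ (by fun_prop)) (hint _ (by fun_prop)) fun u => ?_
        have h0 : 0 ≤ c * f u ^ 2 := by positivity
        have h1 : 1 - c * f u ^ 2 ≤ Real.exp (-(c * f u ^ 2)) := by
          linarith [Real.add_one_le_exp (-(c * f u ^ 2))]
        have h2 : Real.exp (c * f u ^ 2) * Real.exp (-(c * f u ^ 2)) = 1 := by
          rw [← Real.exp_add]; simp
        have h3 : Real.exp (c * f u ^ 2) ≤ Real.exp B := Real.exp_le_exp.mpr (hB u)
        have h4 := mul_le_mul_of_nonneg_left h1 (Real.exp_nonneg (c * f u ^ 2))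
        have h5 := mul_le_mul_of_nonneg_left h3 h0
        simp only
        nlinarith
    _ = 1 + c * Real.exp B * ∫ u, f u ^ 2 ∂μ := by
        rw [integral_add (by simp) (hint _ (by fun_prop)), integral_const_mul]
        simp
    _ ≤ _ := by linarith [Real.add_one_le_exp (c * Real.exp B * ∫ u, f u ^ 2 ∂μ)]

/-- The exponent is `‖f‖²` times the total number of sampling points, up to a constant that
depends on `f` only through its uniform bound. -/
theorem chiSqBound_sampleLaw {μ : Measure U} [IsProbabilityMeasure μ] (hD : vD ≠ 0)
    {ζ : ℝ} {n : ℕ} {X : Fin n → Fin P → ℝ} (hX : ∀ i p, |X i p| ≤ ζ) (m : Fin n → ℕ)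
    {f : C(U, ℝ)} {B : ℝ} (hB : ∀ u, f u ^ 2 ≤ B) :
    ChiSqBound ((gaussianModel L p₀ φ vE vD f).sampleLaw μ X m)
      ((gaussianModel L p₀ φ vE vD 0).sampleLaw μ X m)
      (ENNReal.ofReal (Real.exp
        (ζ ^ 2 / vD * Real.exp (ζ ^ 2 / vD * B) * (∫ u, f u ^ 2 ∂μ) * ∑ i, (m i : ℝ)))) := by
  refine (ChiSqBound.pi fun i => chiSqBound_subjectLaw hD f (X i) (m i)).mono ?_
  have hI : 0 ≤ ∫ u, f u ^ 2 ∂μ := integral_nonneg fun u => sq_nonneg _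
  rw [← ENNReal.ofReal_prod_of_nonneg
    fun _ _ => pow_nonneg (integral_nonneg fun _ => Real.exp_nonneg _) _, Finset.mul_sum,
    Real.exp_sum]
  refine ENNReal.ofReal_le_ofReal (Finset.prod_le_prod
    (fun _ _ => pow_nonneg (integral_nonneg fun _ => Real.exp_nonneg _) _) fun i _ => ?_)
  rw [mul_comm _ (m i : ℝ), Real.exp_nat_mul]
  refine pow_le_pow_left₀ (integral_nonneg fun _ => Real.exp_nonneg _) ?_ _
  have hx : X i p₀ ^ 2 ≤ ζ ^ 2 := sq_le_sq' (abs_le.mp (hX i p₀)).1 (abs_le.mp (hX i p₀)).2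
  have h1 : ∀ u, (X i p₀ * f u) ^ 2 / vD = X i p₀ ^ 2 / vD * f u ^ 2 := fun u => by ring
  simp_rw [h1]
  have hle : X i p₀ ^ 2 / vD ≤ ζ ^ 2 / vD := by gcongr
  refine (integral_exp_sq_le (B := ζ ^ 2 / vD * B) (by positivity) fun u => ?_).trans ?_
  · exact mul_le_mul hle (hB u) (sq_nonneg _) (by positivity)
  · gcongr

/-- The overlap count for testing: an estimate can be close only to hypotheses that are close to
one another, so if few hypotheses are close to any given one, then under some hypothesis the
estimate is unlikely to be close. -/
theorem exists_sampleLaw_le {μ : Measure U} [IsProbabilityMeasure μ] (hL : 0 < L) {n : ℕ}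
    {X : Fin n → Fin P → ℝ} {m : Fin n → ℕ}
    {b : ((i : Fin n) → Fin (m i) → U × (Fin L → ℝ)) → Fin L → Fin P → Lp ℝ 2 μ}
    (hb : ∀ ℓ p, StronglyMeasurable fun x => b x ℓ p)
    {Θ : Type*} [Fintype Θ] [Nonempty Θ] (f : Θ → C(U, ℝ)) {C V r : ℝ} (hC0 : 0 ≤ C)
    (hC : ∀ t, ChiSqBound ((gaussianModel L p₀ φ vE vD (f t)).sampleLaw μ X m)
      ((gaussianModel L p₀ φ vE vD 0).sampleLaw μ X m) (ENNReal.ofReal C))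
    (hV0 : 0 ≤ V)
    (hV : ∀ t, open Classical in ((Finset.univ.filter fun t' =>
      ‖ContinuousMap.toLp 2 μ ℝ (f t) - ContinuousMap.toLp 2 μ ℝ (f t')‖ ^ 2 ≤ 4 * r).card : ℝ)
        ≤ V) :
    ∃ t, (gaussianModel L p₀ φ vE vD (f t)).sampleLaw μ X m
      {x | (gaussianModel L p₀ φ vE vD (f t)).excessRisk μ (b x) ≤ r}
        ≤ ENNReal.ofReal √(C * (V / Fintype.card Θ)) := by
  classical
  set A : Θ → Set ((i : Fin n) → Fin (m i) → U × (Fin L → ℝ)) := fun t =>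
    {x | (gaussianModel L p₀ φ vE vD (f t)).excessRisk μ (b x) ≤ r} with hAdef
  have hA : ∀ t, MeasurableSet (A t) := fun t => by
    refine measurableSet_le (f := fun x => (gaussianModel L p₀ φ vE vD (f t)).excessRisk μ (b x))
      ?_ measurable_const
    unfold Model.excessRisk
    refine Finset.measurable_sum _ fun p _ => Finset.measurable_sum _ fun ℓ _ => ?_
    exact ((hb ℓ p).sub stronglyMeasurable_const).norm.measurable.pow_const 2
  have hnear : ∀ t x, x ∈ A t →
      ‖b x ⟨0, hL⟩ p₀ - ContinuousMap.toLp 2 μ ℝ (f t)‖ ^ 2 ≤ r := fun t x hx => by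
    refine le_trans ?_ hx
    unfold Model.excessRisk
    have h1 := Finset.single_le_sum (f := fun p => ∑ ℓ, ‖b x ℓ p - ContinuousMap.toLp 2 μ ℝ
      ((gaussianModel L p₀ φ vE vD (f t)).β ℓ p)‖ ^ 2)
      (fun p _ => Finset.sum_nonneg fun ℓ _ => sq_nonneg _) (Finset.mem_univ p₀)
    have h2 := Finset.single_le_sum (f := fun ℓ => ‖b x ℓ p₀ - ContinuousMap.toLp 2 μ ℝ
      ((gaussianModel L p₀ φ vE vD (f t)).β ℓ p₀)‖ ^ 2)
      (fun ℓ _ => sq_nonneg _) (Finset.mem_univ (⟨0, hL⟩ : Fin L))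
    refine le_trans ?_ (h2.trans h1)
    simp [gaussianModel]
  have hoverlap : ∀ x, ∑ t, (A t).indicator
        (1 : ((i : Fin n) → Fin (m i) → U × (Fin L → ℝ)) → ℝ≥0∞) x ≤ ENNReal.ofReal V := by
    intro x
    have hsum : ∑ t, (A t).indicator
        (1 : ((i : Fin n) → Fin (m i) → U × (Fin L → ℝ)) → ℝ≥0∞) x
        = ((Finset.univ.filter fun t => x ∈ A t).card : ℝ≥0∞) := by
      rw [Finset.card_filter]
      push_cast
      exact Finset.sum_congr rfl fun t _ => by simp [Set.indicator_apply]
    rw [hsum]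
    by_cases hx : ∃ t, x ∈ A t
    · obtain ⟨t, ht⟩ := hx
      rw [← ENNReal.ofReal_natCast]
      refine ENNReal.ofReal_le_ofReal (le_trans ?_ (hV t))
      refine Nat.cast_le.mpr (Finset.card_le_card fun t' ht' => ?_)
      simp only [Finset.mem_filter, Finset.mem_univ, true_and] at ht' ⊢
      have h1 := hnear t x ht
      have h2 := hnear t' x ht'
      set y := b x ⟨0, hL⟩ p₀
      set g := ContinuousMap.toLp 2 μ ℝ (f t)
      set g' := ContinuousMap.toLp 2 μ ℝ (f t')
      have h3 : ‖g - g'‖ ≤ ‖y - g‖ + ‖y - g'‖ := by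
        rw [norm_sub_rev y g]
        exact norm_sub_le_norm_sub_add_norm_sub g y g'
      -- `(p + q)² ≤ 2 p² + 2 q² ≤ 4 r`
      nlinarith [norm_nonneg (g - g'), norm_nonneg (y - g), norm_nonneg (y - g'),
        sq_nonneg (‖y - g‖ - ‖y - g'‖)]
    · rw [Finset.filter_false_of_mem fun t _ ht => hx ⟨t, ht⟩]
      simp
  obtain ⟨t, ht⟩ := ChiSqBound.exists_measure_sq_le hC hA hoverlap
  refine ⟨t, ?_⟩
  have hcard : (0 : ℝ) < Fintype.card Θ := by exact_mod_cast Fintype.card_pos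
  rw [← ENNReal.ofReal_natCast, ← ENNReal.ofReal_div_of_pos hcard, ← ENNReal.ofReal_mul hC0,
    ← Real.sq_sqrt (x := C * (V / Fintype.card Θ)) (by positivity),
    ENNReal.ofReal_pow (Real.sqrt_nonneg _)] at ht
  exact (ENNReal.pow_right_strictMono two_ne_zero).le_iff_le.mp ht

end

/-! ### Finite combinations of eigenfunctions and the hypercube -/

section

variable {U : Type w} [TopologicalSpace U] [CompactSpace U] [MeasurableSpace U] [BorelSpace U]
  {μ : Measure U} [IsProbabilityMeasure μ] {τ : ℕ → ℝ} {v : ℕ → Lp ℝ 2 μ}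
  {e : ℕ → C(U, ℝ)}

theorem toLp_sum_smul (he : ∀ k, ContinuousMap.toLp 2 μ ℝ (e k) = v k) {N : ℕ} (a : Fin N → ℝ) :
    ContinuousMap.toLp 2 μ ℝ (∑ k, a k • e k) = ∑ k, a k • v k := by
  simp [map_sum, he]

theorem norm_toLp_sub_sq (hv : Orthonormal ℝ v)
    (he : ∀ k, ContinuousMap.toLp 2 μ ℝ (e k) = v k) {N : ℕ} (a b : Fin N → ℝ) :
    ‖ContinuousMap.toLp 2 μ ℝ (∑ k, a k • e k) - ContinuousMap.toLp 2 μ ℝ (∑ k, b k • e k)‖ ^ 2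
      = ∑ k, (a k - b k) ^ 2 := by
  rw [toLp_sum_smul he, toLp_sum_smul he, ← Finset.sum_sub_distrib, ← real_inner_self_eq_norm_sq]
  simp_rw [← sub_smul]
  have hv' : Orthonormal ℝ fun k : Fin N => v k := hv.comp _ Fin.val_injective
  rw [hv'.inner_sum]
  simp [sq]

theorem integral_sum_smul_sq (hv : Orthonormal ℝ v)
    (he : ∀ k, ContinuousMap.toLp 2 μ ℝ (e k) = v k) {N : ℕ} (a : Fin N → ℝ) :
    ∫ u, (∑ k, a k • e k : C(U, ℝ)) u ^ 2 ∂μ = ∑ k, a k ^ 2 := by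
  have := norm_toLp_sub_sq hv he a 0
  simp only [Pi.zero_apply, zero_smul, Finset.sum_const_zero, map_zero, sub_zero] at this
  rw [← this, ← real_inner_self_eq_norm_sq, ContinuousMap.inner_toLp]
  simp [sq]

theorem sum_smul_mem_rkhsBall (hτ : ∀ k, 0 < τ k) (hv : Orthonormal ℝ v)
    (he : ∀ k, ContinuousMap.toLp 2 μ ℝ (e k) = v k) {N : ℕ} {a : Fin N → ℝ} {M₀ : ℝ}
    (ha : ∑ k, a k ^ 2 / τ k ≤ M₀ ^ 2) : ∑ k, a k • e k ∈ rkhsBall μ τ v M₀ := by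
  have hmem : ContinuousMap.toLp 2 μ ℝ (∑ k, a k • e k) ∈
      (Submodule.span ℝ (Set.range v)).topologicalClosure := by
    rw [toLp_sum_smul he]
    exact Submodule.le_topologicalClosure _ <| Submodule.sum_mem _ fun k _ =>
      Submodule.smul_mem _ _ (Submodule.subset_span ⟨k, rfl⟩)
  simp only [rkhsBall, Set.mem_ofPred_eq, rkhsNormSq, if_pos hmem]
  rw [toLp_sum_smul he]
  have hin : ∀ l : ℕ, inner ℝ (∑ k, a k • v k) (v l) = if h : l < N then a ⟨l, h⟩ else 0 := by
    intro l
    simp only [sum_inner, inner_smul_left, orthonormal_iff_ite.mp hv, conj_trivial, mul_ite,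
      mul_one, mul_zero]
    split_ifs with h
    · rw [Finset.sum_eq_single ⟨l, h⟩]
      · simp
      · intro b _ hb
        rw [if_neg fun hbl => hb (Fin.ext hbl)]
      · simp
    · exact Finset.sum_eq_zero fun k _ => if_neg fun (hk : (k : ℕ) = l) => h (hk ▸ k.2)
  rw [tsum_eq_sum (s := Finset.range N) fun l hl => by
    rw [hin, dif_neg (by simpa using hl)]; simp]
  rw [← ENNReal.ofReal_sum_of_nonneg fun l _ => div_nonneg (sq_nonneg _) (hτ l).le]
  refine ENNReal.ofReal_le_ofReal (le_trans (le_of_eq ?_) ha)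
  rw [Finset.sum_range]
  exact Finset.sum_congr rfl fun k _ => by rw [hin, dif_pos k.2]

end

/-- A Hamming ball whose radius is a quarter of the dimension contains an exponentially small part
of the hypercube. -/
theorem card_hammingBall_le (N : ℕ) (θ : Fin N → Bool) :
    ((Finset.univ.filter fun θ' => 4 * hammingDist θ θ' ≤ N).card : ℝ) ≤ (9 / 5) ^ N := by
  -- The sum is a product over the coordinates, each of which contributes `1 + 1 / 2`.
  have hsum : ∑ θ' : Fin N → Bool, (1 / 2 : ℝ) ^ hammingDist θ θ' = (3 / 2) ^ N := by
    have h1 : ∀ θ' : Fin N → Bool, (1 / 2 : ℝ) ^ hammingDist θ θ'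
        = ∏ i, if θ i ≠ θ' i then (1 / 2 : ℝ) else 1 := fun θ' => by
      rw [Finset.prod_ite]; simp [hammingDist]
    have h2 := Finset.prod_univ_sum (fun _ : Fin N => (Finset.univ : Finset Bool))
      fun i s => if θ i ≠ s then (1 / 2 : ℝ) else 1
    rw [Fintype.piFinset_univ] at h2
    simp_rw [h1]
    rw [← h2]
    have h3 : ∀ i, ∑ s : Bool, (if θ i ≠ s then (1 / 2 : ℝ) else 1) = 3 / 2 := fun i => by
      cases θ i <;> norm_num
    rw [Finset.prod_congr rfl fun i _ => h3 i]
    simp [div_pow]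
  have hterm : ∀ θ' ∈ Finset.univ.filter fun θ' => 4 * hammingDist θ θ' ≤ N,
      ((6 / 5 : ℝ) ^ N)⁻¹ ≤ (1 / 2 : ℝ) ^ hammingDist θ θ' := fun θ' h => by
    rw [one_div, inv_pow]
    refine inv_anti₀ (by positivity) ?_
    -- `2 ≤ (6 / 5) ^ 4` trades `2 ^ (N / 4)` for `(6 / 5) ^ N`.
    calc (2 : ℝ) ^ hammingDist θ θ' ≤ ((6 / 5) ^ 4) ^ hammingDist θ θ' := by
          gcongr; norm_num
      _ = (6 / 5) ^ (4 * hammingDist θ θ') := (pow_mul _ _ _).symm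
      _ ≤ (6 / 5) ^ N := pow_le_pow_right₀ (by norm_num) (by simpa using h)
  have h4 := (Finset.card_nsmul_le_sum _ _ _ hterm).trans
    (Finset.sum_le_sum_of_subset_of_nonneg (Finset.filter_subset _ Finset.univ)
      fun _ _ _ => by positivity)
  rw [hsum, nsmul_eq_mul, ← div_eq_mul_inv, div_le_iff₀ (by positivity), ← mul_pow] at h4
  norm_num at h4
  exact h4

/-! ### The two lower bounds -/

/-- The harmonic mean of the numbers of sampling points is at least one. -/
theorem le_mul_harmMean {n : ℕ} (hn : 0 < n) {m : Fin n → ℕ} (hm : ∀ i, 1 ≤ m i) :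
    (n : ℝ) ≤ n * harmMean m := by
  have hn' : (0 : ℝ) < n := by exact_mod_cast hn
  have hpos : ∀ i, (0 : ℝ) < (m i : ℝ)⁻¹ := fun i => by
    have := hm i
    positivity
  have hsum : ∑ i, (m i : ℝ)⁻¹ ≤ n := by
    refine (Finset.sum_le_card_nsmul _ _ 1 fun i _ => ?_).trans_eq (by simp)
    exact inv_le_one_of_one_le₀ (by exact_mod_cast hm i)
  have hsum0 : 0 < ∑ i, (m i : ℝ)⁻¹ :=
    Finset.sum_pos (fun i _ => hpos i) ⟨⟨0, hn⟩, Finset.mem_univ _⟩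
  refine le_mul_of_one_le_right hn'.le ?_
  rw [harmMean, one_le_div hsum0]
  exact hsum

variable {U : Type w} [TopologicalSpace U] [CompactSpace U] [MeasurableSpace U] [BorelSpace U]
  {L P : ℕ} {p₀ : Fin P} {vE vD : NNReal}
  {μ : Measure U} [IsProbabilityMeasure μ] {τ : ℕ → ℝ} {v : ℕ → Lp ℝ 2 μ} {e : ℕ → C(U, ℝ)}
  {M₀ ζ : ℝ} {X : (n : ℕ) → Fin n → Fin P → ℝ} {m : (n : ℕ) → Fin n → ℕ}
  {est : (n : ℕ) → ((i : Fin n) → Fin (m n i) → U × (Fin L → ℝ)) → Fin L → Fin P → Lp ℝ 2 μ}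

/-- The parametric part of the lower bound: the hypotheses are equally spaced multiples of the
first eigenfunction, at mutual distances of order `n^{-1/2}`. Their number is large, yet the
likelihood ratios stay bounded because the spacing is chosen small depending on this number. -/
theorem exists_parametric_lower_bound (hL : 0 < L) (hvE : vE ≠ 0) (hM₀ : 0 < M₀)
    (hτ : ∀ k, 0 < τ k) (hv : Orthonormal ℝ v)
    (he : ∀ k, ContinuousMap.toLp 2 μ ℝ (e k) = v k)
    (hX : ∀ n i p, |X n i p| ≤ ζ)
    (hest : ∀ n ℓ p, StronglyMeasurable fun x => est n x ℓ p) {η : ℝ} (hη : 0 < η) :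
    ∃ ε > 0, ∀ᶠ n in atTop, ∃ f ∈ rkhsBall μ τ v M₀,
      (gaussianModel L p₀ (e 0) vE vD f).sampleLaw μ (X n) (m n)
        {x | (gaussianModel L p₀ (e 0) vE vD f).excessRisk μ (est n x) ≤ ε * (n : ℝ)⁻¹}
          ≤ ENNReal.ofReal η := by
  have hvE' : (0 : ℝ) < vE := by exact_mod_cast pos_iff_ne_zero.mpr hvE
  have hτ0 := hτ 0
  obtain ⟨N, hN⟩ := exists_nat_gt (max 1 (Real.exp 1 / η ^ 2))
  have hN1 : (1 : ℝ) < N := (le_max_left _ _).trans_lt hN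
  have hN2 : Real.exp 1 / η ^ 2 < N := (le_max_right _ _).trans_lt hN
  have hN0 : 0 < N := by
    rcases Nat.eq_zero_or_pos N with h | h
    · simp [h] at hN1; linarith
    · exact h
  have : Nonempty (Fin N) := ⟨⟨0, hN0⟩⟩
  -- `κ / n` is the squared spacing: the first condition bounds the likelihood ratios, the second
  -- places the hypotheses in the RKHS ball.
  obtain ⟨κ, hκ, hκ1, hκ2⟩ : ∃ κ : ℝ, 0 < κ ∧ ζ ^ 2 * (N ^ 2 * κ) / vE ≤ 1 ∧
      N ^ 2 * κ / τ 0 ≤ M₀ ^ 2 := by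
    have hc1 : ∀ᶠ κ : ℝ in 𝓝[>] 0, ζ ^ 2 * (N ^ 2 * κ) / vE < 1 := by
      have : Tendsto (fun κ : ℝ => ζ ^ 2 * (N ^ 2 * κ) / vE) (𝓝 0) (𝓝 0) := by
        have : Continuous fun κ : ℝ => ζ ^ 2 * (N ^ 2 * κ) / vE := by fun_prop
        simpa using this.tendsto 0
      exact (this.mono_left nhdsWithin_le_nhds).eventually_lt_const one_pos
    have hc2 : ∀ᶠ κ : ℝ in 𝓝[>] 0, N ^ 2 * κ / τ 0 < M₀ ^ 2 := by
      have : Tendsto (fun κ : ℝ => N ^ 2 * κ / τ 0) (𝓝 0) (𝓝 0) := by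
        have : Continuous fun κ : ℝ => N ^ 2 * κ / τ 0 := by fun_prop
        simpa using this.tendsto 0
      exact (this.mono_left nhdsWithin_le_nhds).eventually_lt_const (by positivity)
    obtain ⟨κ, h1, h2, h3⟩ := (hc1.and (hc2.and self_mem_nhdsWithin)).exists
    exact ⟨κ, h3, h1.le, h2.le⟩
  refine ⟨κ / 8, by positivity, ?_⟩
  filter_upwards [eventually_ge_atTop 1] with n hn
  have hn0 : (0 : ℝ) < n := by exact_mod_cast hn
  have hn1 : (1 : ℝ) ≤ n := by exact_mod_cast hn
  set s := √(κ / n) with hs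
  have hs2 : s ^ 2 = κ / n := Real.sq_sqrt (by positivity)
  have hj : ∀ j : Fin N, ((j : ℝ) * s) ^ 2 ≤ N ^ 2 * κ / n := fun j => by
    rw [mul_pow, hs2, mul_div_assoc]
    have : (j : ℝ) ≤ N := by exact_mod_cast j.2.le
    gcongr
  have hsum : ∀ t : ℝ, ∑ _k : Fin 1, t • e _k = t • e 0 := fun t => by simp
  have hball : ∀ j : Fin N, ((j : ℝ) * s) • e 0 ∈ rkhsBall μ τ v M₀ := fun j => by
    rw [← hsum]
    refine sum_smul_mem_rkhsBall hτ hv he ?_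
    simp only [Finset.univ_unique, Finset.sum_singleton, Fin.default_eq_zero, Fin.val_zero]
    refine le_trans ?_ hκ2
    gcongr
    exact (hj j).trans (div_le_self (by positivity) hn1)
  obtain ⟨j, hj⟩ := exists_sampleLaw_le (p₀ := p₀) (φ := e 0) (vE := vE) (vD := vD) hL
    (X := X n) (hest n) (fun j : Fin N => ((j : ℝ) * s) • e 0) (C := Real.exp 1) (V := 1)
    (r := κ / 8 * (n : ℝ)⁻¹) (Real.exp_nonneg _) (fun j => by
      refine (chiSqBound_sampleLaw_smul hvE (hX n) (m n) _).mono
        (ENNReal.ofReal_le_ofReal (Real.exp_le_exp.mpr (le_trans ?_ hκ1)))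
      calc (n : ℝ) * (ζ ^ 2 * ((j : ℝ) * s) ^ 2 / vE)
          ≤ n * (ζ ^ 2 * (N ^ 2 * κ / n) / vE) := by gcongr; exact hj j
        _ = ζ ^ 2 * (N ^ 2 * κ) / vE := by field_simp) zero_le_one (fun j => by
      classical
      rw [Nat.cast_le_one, Finset.card_le_one]
      have hsub : ∀ i : Fin N, ‖ContinuousMap.toLp 2 μ ℝ (((j : ℝ) * s) • e 0) -
          ContinuousMap.toLp 2 μ ℝ (((i : ℝ) * s) • e 0)‖ ^ 2 ≤ 4 * (κ / 8 * (n : ℝ)⁻¹) →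
          i = j := fun i hi => by
        rw [← hsum, ← hsum, norm_toLp_sub_sq hv he] at hi
        simp only [Finset.univ_unique, Finset.sum_singleton] at hi
        rw [← sub_mul, mul_pow, hs2] at hi
        by_contra hij
        have h1 : (1 : ℝ) ≤ ((j : ℝ) - i) ^ 2 := by
          have h2 : ((j : ℕ) : ℤ) - (i : ℕ) ≠ 0 := fun h => hij (Fin.ext (by omega))
          have h3 : (1 : ℤ) ≤ (((j : ℕ) : ℤ) - (i : ℕ)) ^ 2 := by
            have := sq_pos_of_ne_zero h2
            omega
          exact_mod_cast h3
        have h4 : 0 < κ / n := by positivity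
        have h5 : 4 * (κ / 8 * (n : ℝ)⁻¹) = κ / n / 2 := by field_simp; norm_num
        nlinarith
      intro a ha b hb
      simp only [Finset.mem_filter, Finset.mem_univ, true_and] at ha hb
      rw [hsub a ha, hsub b hb])
  refine ⟨_, hball j, hj.trans (ENNReal.ofReal_le_ofReal ?_)⟩
  rw [Real.sqrt_le_left hη.le, Fintype.card_fin, mul_one_div]
  rw [div_lt_iff₀ (by positivity)] at hN2
  rw [div_le_iff₀ (by positivity)]
  linarith

/-- The nonparametric part of the lower bound: the hypotheses form a hypercube spanned by the first
`N ≍ (n m)^{1/(2h+1)}` eigenfunctions, with coefficients of order `(n m)^{-1/2}`. -/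
theorem exists_nonparametric_lower_bound (hL : 0 < L) (hvD : vD ≠ 0) (hM₀ : 0 < M₀)
    (hτ : ∀ k, 0 < τ k) (hτa : Antitone τ) (hv : Orthonormal ℝ v)
    (he : ∀ k, ContinuousMap.toLp 2 μ ℝ (e k) = v k)
    {K : U → U → ℝ} (heK : ∀ N u, ∑ k ∈ Finset.range N, τ k * (e k u) ^ 2 ≤ K u u)
    {B : ℝ} (hB0 : 0 ≤ B) (hB : ∀ u, K u u ≤ B)
    {h : ℝ} (hh : 0 < h) {c₁ : ℝ} (hc₁ : 0 < c₁)
    (hτc : ∀ᶠ k : ℕ in atTop, c₁ * ((k : ℝ) + 1) ^ (-(2 * h)) ≤ τ k)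
    (hX : ∀ n i p, |X n i p| ≤ ζ) (hm : ∀ n i, 1 ≤ m n i) {c₂ : ℝ} (hc₂ : 0 < c₂)
    (hmean : ∀ᶠ n in atTop, arithMean (m n) ≤ c₂ * harmMean (m n))
    (hest : ∀ n ℓ p, StronglyMeasurable fun x => est n x ℓ p) :
    ∃ ε > 0, ∀ η > 0, ∀ᶠ n in atTop, ∃ f ∈ rkhsBall μ τ v M₀,
      (gaussianModel L p₀ (e 0) vE vD f).sampleLaw μ (X n) (m n)
        {x | (gaussianModel L p₀ (e 0) vE vD f).excessRisk μ (est n x) ≤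
          ε * (n * harmMean (m n)) ^ (-(2 * h) / (2 * h + 1))} ≤ ENNReal.ofReal η := by
  have hvD' : (0 : ℝ) < vD := by exact_mod_cast pos_iff_ne_zero.mpr hvD
  set β : ℝ := 1 / (2 * h + 1) with hβ
  have hβ0 : 0 < β := by positivity
  set q : ℝ := ζ ^ 2 / vD * Real.exp (ζ ^ 2 / vD * (M₀ ^ 2 * B)) with hq
  have hq0 : 0 ≤ q := by positivity
  -- `κ / (n m)` is the squared coefficient: the first condition bounds the likelihood ratios, the
  -- second places the hypercube in the RKHS ball.
  obtain ⟨κ, hκ, hκ1, hκ2⟩ : ∃ κ : ℝ, 0 < κ ∧ q * κ * c₂ ≤ 1 / 20 ∧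
      2 ^ (2 * h + 1) * κ / c₁ ≤ M₀ ^ 2 := by
    have hc1 : ∀ᶠ κ : ℝ in 𝓝[>] 0, q * κ * c₂ < 1 / 20 := by
      have : Tendsto (fun κ : ℝ => q * κ * c₂) (𝓝 0) (𝓝 0) := by
        have : Continuous fun κ : ℝ => q * κ * c₂ := by fun_prop
        simpa using this.tendsto 0
      exact (this.mono_left nhdsWithin_le_nhds).eventually_lt_const (by norm_num)
    have hc2 : ∀ᶠ κ : ℝ in 𝓝[>] 0, 2 ^ (2 * h + 1) * κ / c₁ < M₀ ^ 2 := by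
      have : Tendsto (fun κ : ℝ => 2 ^ (2 * h + 1) * κ / c₁) (𝓝 0) (𝓝 0) := by
        have : Continuous fun κ : ℝ => 2 ^ (2 * h + 1) * κ / c₁ := by fun_prop
        simpa using this.tendsto 0
      exact (this.mono_left nhdsWithin_le_nhds).eventually_lt_const (by positivity)
    obtain ⟨κ, h1, h2, h3⟩ := (hc1.and (hc2.and self_mem_nhdsWithin)).exists
    exact ⟨κ, h3, h1.le, h2.le⟩
  refine ⟨κ / 16, by positivity, fun η hη => ?_⟩
  -- `T n` is the effective total number of observations, `N n` the dimension of the hypercube.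
  set T : ℕ → ℝ := fun n => n * harmMean (m n) with hT
  set N : ℕ → ℕ := fun n => ⌈T n ^ β⌉₊ with hNdef
  have hTn : ∀ᶠ n : ℕ in atTop, (n : ℝ) ≤ T n := by
    filter_upwards [eventually_ge_atTop 1] with n hn
    exact le_mul_harmMean hn (hm n)
  have hTtop : Tendsto T atTop atTop := tendsto_atTop_mono' _ hTn tendsto_natCast_atTop_atTop
  have hNtop : Tendsto N atTop atTop :=
    tendsto_nat_ceil_atTop.comp ((tendsto_rpow_atTop hβ0).comp hTtop)
  have hNpow : ∀ᶠ n in atTop, (18 / 19 : ℝ) ^ N n < η ^ 2 :=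
    ((tendsto_pow_atTop_nhds_zero_of_lt_one (by norm_num) (by norm_num)).comp
      hNtop).eventually_lt_const (by positivity)
  have hτN : ∀ᶠ n in atTop, c₁ * (((N n - 1 : ℕ) : ℝ) + 1) ^ (-(2 * h)) ≤ τ (N n - 1) :=
    ((tendsto_sub_atTop_nat 1).comp hNtop).eventually hτc
  filter_upwards [hTn, hNpow, hτN, hmean, eventually_ge_atTop 1] with n hTn hNpow hτN hmean hn
  have hn0 : (0 : ℝ) < n := by exact_mod_cast hn
  have hn1 : (1 : ℝ) ≤ n := by exact_mod_cast hn
  have hT1 : 1 ≤ T n := hn1.trans hTn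
  have hT0 : 0 < T n := one_pos.trans_le hT1
  have hTβ1 : 1 ≤ T n ^ β := Real.one_le_rpow hT1 hβ0.le
  have hNlo : T n ^ β ≤ N n := Nat.le_ceil _
  have hNhi : (N n : ℝ) ≤ 2 * T n ^ β := by
    have := (Nat.ceil_lt_add_one (zero_le_one.trans hTβ1)).le
    simp only [hNdef]
    linarith
  have hN1 : 1 ≤ N n := by exact_mod_cast hTβ1.trans hNlo
  have hN0 : (0 : ℝ) < N n := by exact_mod_cast hN1
  have hNcast : ((N n - 1 : ℕ) : ℝ) + 1 = N n := by exact_mod_cast Nat.sub_add_cancel hN1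
  rw [hNcast] at hτN
  -- With `τ (N - 1) ≥ c₁ N ^ (-2h)`, this keeps the RKHS norms bounded.
  have hNT : (N n : ℝ) ^ (2 * h + 1) ≤ 2 ^ (2 * h + 1) * T n := by
    calc (N n : ℝ) ^ (2 * h + 1) ≤ (2 * T n ^ β) ^ (2 * h + 1) := by gcongr
      _ = 2 ^ (2 * h + 1) * T n := by
        rw [Real.mul_rpow (by norm_num) (by positivity), ← Real.rpow_mul hT0.le, hβ,
          one_div_mul_cancel (by positivity), Real.rpow_one]
  have hTpow : T n ^ (-(2 * h) / (2 * h + 1)) = T n ^ β / T n := by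
    rw [← Real.rpow_sub_one hT0.ne']
    congr 1
    rw [hβ]
    field_simp
    ring
  have hTsum : ∑ i, (m n i : ℝ) ≤ c₂ * T n := by
    rw [arithMean, div_le_iff₀ hn0] at hmean
    simp only [hT]
    linarith
  set a : ℝ := √(κ / T n) with ha
  have ha2 : a ^ 2 = κ / T n := Real.sq_sqrt (by positivity)
  set α : (Fin (N n) → Bool) → Fin (N n) → ℝ := fun θ k => if θ k then a else 0 with hα
  have hα2 : ∀ θ k, α θ k ^ 2 ≤ κ / T n := fun θ k => by
    simp only [hα]
    split_ifs
    · exact ha2.le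
    · simp; positivity
  have hrkhs : ∀ θ, ∑ k, α θ k ^ 2 / τ k ≤ M₀ ^ 2 := fun θ => by
    have h1 : ∀ k : Fin (N n), α θ k ^ 2 / τ k ≤ κ / T n / (c₁ * (N n : ℝ) ^ (-(2 * h))) :=
      fun k => by
        have : τ (N n - 1) ≤ τ k := hτa (by omega)
        have h2 := hα2 θ k
        have h3 := hτN.trans this
        gcongr
    refine (Finset.sum_le_card_nsmul _ _ _ fun k _ => h1 k).trans ?_
    rw [Finset.card_univ, Fintype.card_fin, nsmul_eq_mul]
    calc (N n : ℝ) * (κ / T n / (c₁ * (N n : ℝ) ^ (-(2 * h))))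
        = (N n : ℝ) ^ (2 * h + 1) * (κ / (T n * c₁)) := by
          rw [Real.rpow_add_one hN0.ne', Real.rpow_neg hN0.le]
          field_simp
      _ ≤ 2 ^ (2 * h + 1) * T n * (κ / (T n * c₁)) := by gcongr
      _ = 2 ^ (2 * h + 1) * κ / c₁ := by field_simp
      _ ≤ _ := hκ2
  have hsup : ∀ θ u, (∑ k, α θ k • e k : C(U, ℝ)) u ^ 2 ≤ M₀ ^ 2 * B := fun θ u => by
    refine (sum_smul_apply_sq_le hτ heK (α θ) u).trans ?_
    have h1 : 0 ≤ ∑ k, α θ k ^ 2 / τ k :=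
      Finset.sum_nonneg fun k _ => div_nonneg (sq_nonneg _) (hτ k).le
    calc (∑ k, α θ k ^ 2 / τ k) * K u u ≤ (∑ k, α θ k ^ 2 / τ k) * B := by
          gcongr; exact hB u
      _ ≤ _ := by gcongr; exact hrkhs θ
  have hdist : ∀ θ θ', ∑ k, (α θ k - α θ' k) ^ 2 = κ / T n * hammingDist θ θ' := fun θ θ' => by
    have h1 : ∀ k, (α θ k - α θ' k) ^ 2 = if θ k ≠ θ' k then κ / T n else 0 := fun k => by
      simp only [hα]
      cases θ k <;> cases θ' k <;> simp [ha2]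
    simp_rw [h1]
    rw [← Finset.sum_filter, Finset.sum_const, nsmul_eq_mul, mul_comm]
    rfl
  obtain ⟨θ, hθ⟩ := exists_sampleLaw_le (p₀ := p₀) (φ := e 0) (vE := vE) (vD := vD) hL
    (X := X n) (hest n) (fun θ => ∑ k, α θ k • e k) (C := Real.exp (1 / 20) ^ N n)
    (V := (9 / 5) ^ N n) (r := κ / 16 * T n ^ (-(2 * h) / (2 * h + 1))) (by positivity)
    (fun θ => by
      refine (chiSqBound_sampleLaw hvD (hX n) (m n) (hsup θ)).mono
        (ENNReal.ofReal_le_ofReal ?_)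
      rw [← Real.exp_nat_mul, integral_sum_smul_sq hv he, ← hq]
      refine Real.exp_le_exp.mpr ?_
      have h1 : ∑ k, α θ k ^ 2 ≤ N n * (κ / T n) :=
        (Finset.sum_le_card_nsmul _ _ _ fun k _ => hα2 θ k).trans_eq (by simp)
      have h2 : 0 ≤ ∑ k, α θ k ^ 2 := Finset.sum_nonneg fun k _ => sq_nonneg _
      calc q * (∑ k, α θ k ^ 2) * ∑ i, (m n i : ℝ)
          ≤ q * (N n * (κ / T n)) * (c₂ * T n) := by gcongr
        _ = N n * (q * κ * c₂) := by field_simp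
        _ ≤ N n * (1 / 20) := by gcongr) (by positivity)
    (fun θ => by
      refine le_trans (Nat.cast_le.mpr (Finset.card_le_card fun θ' hθ' => ?_))
        (card_hammingBall_le (N n) θ)
      simp only [Finset.mem_filter, Finset.mem_univ, true_and] at hθ' ⊢
      rw [norm_toLp_sub_sq hv he, hdist, hTpow] at hθ'
      have h1 : (hammingDist θ θ' : ℝ) * 4 ≤ T n ^ β := by
        have h2 : κ / T n * hammingDist θ θ' ≤ κ / T n * (T n ^ β / 4) :=
          hθ'.trans_eq (by field_simp; norm_num)
        have := le_of_mul_le_mul_left h2 (by positivity)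
        linarith
      have h3 : (4 * hammingDist θ θ' : ℝ) ≤ N n := by linarith
      exact_mod_cast h3)
  refine ⟨_, sum_smul_mem_rkhsBall hτ hv he (hrkhs θ), hθ.trans (ENNReal.ofReal_le_ofReal ?_)⟩
  rw [Real.sqrt_le_left hη.le]
  refine le_trans ?_ hNpow.le
  have hcard : (Fintype.card (Fin (N n) → Bool) : ℝ) = 2 ^ N n := by simp
  rw [hcard, ← div_pow, ← mul_pow]
  refine pow_le_pow_left₀ (by positivity) ?_ _
  have h1 : Real.exp (1 / 20) ≤ 20 / 19 := by
    have h2 := Real.add_one_le_exp (-(1 / 20 : ℝ))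
    have h3 : Real.exp (1 / 20) * Real.exp (-(1 / 20)) = 1 := by rw [← Real.exp_add]; simp
    nlinarith [Real.exp_pos (1 / 20)]
  linarith

end FunReg

theorem theorem1 {U : Type*} [TopologicalSpace U] [CompactSpace U] [T2Space U]
    [SecondCountableTopology U] [MeasurableSpace U] [BorelSpace U]
    (μ : Measure U) [IsProbabilityMeasure μ] [μ.IsOpenPosMeasure]
    (K : U → U → ℝ) (hK : FunReg.IsKernel K)
    (τ : ℕ → ℝ) (v : ℕ → Lp ℝ 2 μ) (hτv : FunReg.IsEigensystem K μ τ v)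
    (h : ℝ) (hh : 1 ≤ h)
    (hτ : τ =Θ[atTop] fun k : ℕ => ((k : ℝ) + 1) ^ (-(2 * h)))
    (L P : ℕ) (hL : 0 < L) (hP : 0 < P)
    (M₀ c C Mε Mδ ζ ν : ℝ) (hM₀ : 0 < M₀) (hc : 0 < c) (hc1 : c ≤ 1) (hC : 1 ≤ C)
    (hMε : 0 < Mε) (hMδ : 0 < Mδ) (hν : 0 < ν)
    (X : (n : ℕ) → Fin n → Fin P → ℝ) (hXζ : ∀ n i p, |X n i p| ≤ ζ)
    (hXν : ∀ᶠ n in atTop, spectrum ℝ (FunReg.designGram (X n)) ⊆ Set.Icc ν⁻¹ ν)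
    (m : (n : ℕ) → Fin n → ℕ) (hm : ∀ n i, 1 ≤ m n i)
    (hmean : (fun n => FunReg.arithMean (m n)) =Θ[atTop] fun n => FunReg.harmMean (m n))
    (est : (n : ℕ) → ((i : Fin n) → Fin (m n i) → U × (Fin L → ℝ)) →
      Fin L → Fin P → Lp ℝ 2 μ)
    (hest : ∀ n ℓ p, StronglyMeasurable fun x => est n x ℓ p) :
    Tendsto
      (fun ε : ℝ => limsup
        (fun n : ℕ => ⨅ (M : FunReg.Model U L P) (_ : M.Admissible μ τ v M₀ c C Mε Mδ),
          M.sampleLaw μ (X n) (m n)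
            {x | M.excessRisk μ (est n x) ≤ ε * FunReg.rate h (m n)})
        atTop)
      (𝓝[>] 0) (𝓝 0) := by
  obtain ⟨e, he, heK⟩ := hτv.exists_continuous hK
  obtain ⟨B, hB⟩ : ∃ B, ∀ u, K u u ≤ B := by
    have hcont : Continuous fun u => K u u := hK.1.comp (continuous_id.prodMk continuous_id)
    obtain ⟨B, hB⟩ := (isCompact_range hcont).bddAbove
    exact ⟨B, fun u => hB ⟨u, rfl⟩⟩
  have hB' : ∀ u, K u u ≤ max B 1 := fun u => (hB u).trans (le_max_left _ _)
  have hB1 : 0 < max B 1 := one_pos.trans_le (le_max_right _ _)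
  have hτ0 := hτv.pos 0
  -- The noise levels are as large as the variance bounds permit.
  set vE : NNReal := ⟨Mε * τ 0 / max B 1, by positivity⟩ with hvE
  set vD : NNReal := ⟨Mδ, hMδ.le⟩ with hvD
  have hvE0 : vE ≠ 0 := fun h0 => by
    have : (vE : ℝ) = 0 := by rw [h0]; rfl
    have h2 : 0 < Mε * τ 0 / max B 1 := by positivity
    exact h2.ne' this
  have hvD0 : vD ≠ 0 := fun h0 => by
    have : (vD : ℝ) = 0 := by rw [h0]; rfl
    exact hMδ.ne' this
  have hEvar : ∀ u, e 0 u ^ 2 * vE ≤ Mε := fun u => by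
    have h1 := heK 1 u
    rw [Finset.sum_range_one] at h1
    change e 0 u ^ 2 * (Mε * τ 0 / max B 1) ≤ Mε
    calc e 0 u ^ 2 * (Mε * τ 0 / max B 1) = Mε * (τ 0 * e 0 u ^ 2) / max B 1 := by ring
      _ ≤ Mε * max B 1 / max B 1 := by gcongr; exact h1.trans (hB' u)
      _ = Mε := by field_simp
  let p₀ : Fin P := ⟨0, hP⟩
  have hadm : ∀ f ∈ FunReg.rkhsBall μ τ v M₀, (FunReg.gaussianModel L p₀ (e 0) vE vD f).Admissible
      μ τ v M₀ c C Mε Mδ := fun f hf =>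
    FunReg.gaussianModel_admissible hc1 hC hEvar le_rfl hf
  obtain ⟨c₁, hc₁, hτc⟩ : ∃ c₁ > 0, ∀ᶠ k : ℕ in atTop,
      c₁ * ((k : ℝ) + 1) ^ (-(2 * h)) ≤ τ k := by
    obtain ⟨a, ha, hbound⟩ := hτ.2.exists_pos
    refine ⟨a⁻¹, by positivity, hbound.bound.mono fun k hk => ?_⟩
    rw [Real.norm_of_nonneg (by positivity), Real.norm_of_nonneg (hτv.pos k).le] at hk
    rwa [inv_mul_le_iff₀ ha]
  obtain ⟨c₂, hc₂, hmean'⟩ : ∃ c₂ > 0, ∀ᶠ n in atTop,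
      FunReg.arithMean (m n) ≤ c₂ * FunReg.harmMean (m n) := by
    obtain ⟨a, ha, hbound⟩ := hmean.1.exists_pos
    refine ⟨a, ha, hbound.bound.mono fun n hn => ?_⟩
    have h0 : 0 ≤ FunReg.harmMean (m n) := by unfold FunReg.harmMean; positivity
    rw [Real.norm_of_nonneg h0] at hn
    exact (le_abs_self _).trans hn
  obtain ⟨ε₁, hε₁, hnonpar⟩ := FunReg.exists_nonparametric_lower_bound (p₀ := p₀) (vE := vE) hL
    hvD0 hM₀ hτv.pos hτv.antitone hτv.orthonormal he heK hB1.le hB' (one_pos.trans_le hh) hc₁ hτc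
    hXζ hm hc₂ hmean' hest
  rw [ENNReal.tendsto_nhds_zero]
  intro δ hδ
  obtain ⟨η, hη, hηδ⟩ : ∃ η : ℝ, 0 < η ∧ ENNReal.ofReal η ≤ δ := by
    obtain ⟨r, hr, hrδ⟩ := ENNReal.lt_iff_exists_nnreal_btwn.mp hδ
    exact ⟨r, by exact_mod_cast hr, by simpa using hrδ.le⟩
  obtain ⟨ε₂, hε₂, hpar⟩ := FunReg.exists_parametric_lower_bound (p₀ := p₀) (vE := vE) (vD := vD)
    (X := X) hL hvE0 hM₀ hτv.pos hτv.orthonormal he hXζ hest hη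
  filter_upwards [Ioo_mem_nhdsGT (show 0 < min ε₁ ε₂ / 2 by positivity)] with ε hε
  refine limsup_le_of_le (h := ?_)
  filter_upwards [hnonpar η hη, hpar] with n h1 h2
  have hr0 : 0 ≤ ((n : ℝ) * FunReg.harmMean (m n)) ^ (-(2 * h) / (2 * h + 1)) := by
    have h0 : 0 ≤ FunReg.harmMean (m n) := by unfold FunReg.harmMean; positivity
    positivity
  have hn0 : 0 ≤ (n : ℝ)⁻¹ := by positivity
  have hε₁' : 2 * ε ≤ ε₁ := by linarith [hε.2, min_le_left ε₁ ε₂]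
  have hε₂' : 2 * ε ≤ ε₂ := by linarith [hε.2, min_le_right ε₁ ε₂]
  have hε0 := hε.1
  -- Up to a factor 2 the rate is the larger of its two terms, which decides between the bounds.
  rcases le_total (n : ℝ)⁻¹ (((n : ℝ) * FunReg.harmMean (m n)) ^ (-(2 * h) / (2 * h + 1)))
    with hle | hle
  · obtain ⟨f, hf, hfη⟩ := h1
    refine iInf₂_le_of_le _ (hadm f hf) ((measure_mono fun x hx => ?_).trans (hfη.trans hηδ))
    simp only [Set.mem_ofPred_eq] at hx ⊢
    refine hx.trans ?_
    rw [FunReg.rate]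
    nlinarith
  · obtain ⟨f, hf, hfη⟩ := h2
    refine iInf₂_le_of_le _ (hadm f hf) ((measure_mono fun x hx => ?_).trans (hfη.trans hηδ))
    simp only [Set.mem_ofPred_eq] at hx ⊢
    refine hx.trans ?_
    rw [FunReg.rate]
    nlinarith
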